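/- **Setting.** Let $|{-1}\rangle,|1\rangle$ be an orthonormal basis of $\mathbb{C}^2$, $\hat\sigma_x=|{-1}\rangle\langle 1|+|1\rangle\langle{-1}|$, $\hat\sigma_z=|1\rangle\langle 1|-|{-1}\rangle\langle{-1}|$, $H_s=\epsilon\hat\sigma_z+\Delta\hat\sigma_x$ with $\epsilon,\Delta\in\mathbb{R}$, $W_s=\hat\sigma_z$, and let $\hat O_s$ be a linear operator on $\mathbb{C}^2$. Let $\beta>0$, let $\nu$ be a Borel measure on $\mathbb{R}$ ($\nu$ is Lebesgue measure for a bath with a spectral density function, a sum of point masses for a discrete bath), and let $J:\mathbb{R}\to\mathbb{R}$ be such that $\omega\mapsto J(\omega)\coth(\beta\omega/2)$ is $\nu$-integrable on $(0,\infty)$. For $\tau_1,\tau_2\in\mathbb{R}$ and $\Delta\tau=|\tau_1|-|\tau_2|$ put $$B(\tau_1,\tau_2)=\frac1\pi\int_{(0,\infty)}J(\omega)\Big[\coth\big(\tfrac{\beta\omega}{2}\big)\cos(\omega\Delta\tau)-\mathrm{i}\sin(\omega\Delta\tau)\Big]\,\nu(\mathrm{d}\omega).$$ **Pairings.** A pairing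 of $\{1,\dots,m\}$ is a set of pairs $(j,k)$, $j<k$, such that every index lies in exactly one pair; $\mathcal{Q}(s_1,\dots,s_m)$ denotes the set of all of them, and $\mathcal{L}_b(s_1,\dots,s_m)=\sum_{\mathfrak q\in\mathcal{Q}(\boldsymbol s)}\prod_{(j,k)\in\mathfrak q}B(s_j,s_k)$ (which is $0$ for odd $m$). For $s_1\le\dots\le s_m$ let $\ell-1=\#\{\boldsymbol s<0\}$ be the number of negative components. The set $\widehat{\mathcal{Q}}(\boldsymbol s)$ consists of those $\mathfrak q\in\mathcal{Q}(\boldsymbol s)$ that have no subset $\mathfrak q'\subset\mathfrak q$ whose pairs cover exactly a set $\{n_1,n_1+1,\dots,n_2\}$ of consecutive indices with $n_1<n_2<\ell-1$ or $\ell<n_1<n_2<m$. Put $\widehat{\mathcal{L}}_b(\boldsymbol s)=\sum_{\mathfrak q\in\widehat{\mathcal{Q}}(\boldsymbol s)}\prod_{(j,k)\in\mathfrak q}B(s_j,s_k)$. **Propagators.** For $a\le b$ let $$G_s^{(0)}(a,b)=\begin{cases}e^{-\mathrm{i}(b-a)H_s},&b<0,\\ e^{-\mathrm{i}(a-b)H_s},&0\le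 a,\\ e^{\mathrm{i}bH_s}\hat O_se^{\mathrm{i}aH_s},&a<0\le b,\end{cases}$$ $\mathcal{U}^{(0)}(a,\boldsymbol s,b)=G_s^{(0)}(s_m,b)W_sG_s^{(0)}(s_{m-1},s_m)W_s\cdots W_sG_s^{(0)}(a,s_1)$, and define the full propagator by $$G(a,b)=G_s^{(0)}(a,b)+\sum_{m=2,4,6,\dots}\mathrm{i}^m\int_{a\le\boldsymbol s\le b}(-1)^{\#\{\boldsymbol s<0\}}\,\mathcal{U}^{(0)}(a,\boldsymbol s,b)\,\mathcal{L}_b(\boldsymbol s)\,\mathrm{d}\boldsymbol s,$$ where $\{a\le\boldsymbol s\le b\}=\{a\le s_1\le\dots\le s_m\le b\}\subset\mathbb{R}^m$. For $i,j\in\{-1,1\}$ and $a\le b$ let $$\widehat{\mathscr{G}}_{ij}(a,b)=\begin{cases}G(a,b),&b<0\text{ or }0\le a,\\ e^{\mathrm{i}bH_s}|i\rangle\langle j|e^{\mathrm{i}aH_s},&a<0\le b,\end{cases}$$ $\widehat{\mathscr{U}}_{ij}(-t,\boldsymbol s,t)=\widehat{\mathscr{G}}_{ij}(s_m,t)W_s\widehat{\mathscr{G}}_{ij}(s_{m-1},s_m)W_s\cdots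 W_s\widehat{\mathscr{G}}_{ij}(-t,s_1)$. **Series.** For $t,\Delta t\ge0$ let $$\widehat{\mathscr{K}}_{ij}(-t,t)=\sum_{m=1,3,5,\dots}\mathrm{i}^{m+1}\int_{-t\le\boldsymbol s\le t}(-1)^{\#\{\boldsymbol s<0\}}\,\widehat{\mathscr{U}}_{ij}(-t,\boldsymbol s,t)\,\widehat{\mathcal{L}}_b(\boldsymbol s,t)\,\mathrm{d}\boldsymbol s,$$ and let $\widehat{\mathscr{D}}^{\Delta t}_{ij}(t+\Delta t)$ be the series for $\widehat{\mathscr{K}}_{ij}(-t-\Delta t,t+\Delta t)$ with the domain of integration in its $m$-th term replaced by $$T^{(m)}_{t+\Delta t}=\{-t-\Delta t\le\boldsymbol s\le t+\Delta t:\ |s_j|\le\Delta t\text{ for some }j\}.$$ Let $b^{ij}_{kl}$ be the numbers with $e^{\mathrm{i}\Delta tH_s}|i\rangle\langle j|e^{-\mathrm{i}\Delta tH_s}=\sum_{k,l\in\{-1,1\}}b^{ij}_{kl}|k\rangle\langle l|$, and let $\mathcal{I}_{\Delta t}(\boldsymbol s)$ be obtained from $\boldsymbol s$ by replacing each $s_k\ge0$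 by $s_k+\Delta t$ and each $s_k<0$ by $s_k-\Delta t$. **Theorem.** All integrands above are integrable on the simplices over which they are integrated, the series for $G(a,b)$ ($a\le b$), $\widehat{\mathscr{K}}_{ij}(-t,t)$ and $\widehat{\mathscr{D}}^{\Delta t}_{ij}(t+\Delta t)$ ($t,\Delta t\ge0$) converge absolutely, and: 1. $G(a+\Delta t,b+\Delta t)=G(a,b)$ for all $a\le b$ and $\Delta t\ge0$ with $b+\Delta t<0$ or $a\ge0$; 2. $\widehat{\mathcal{L}}_b(\mathcal{I}_{\Delta t}(\boldsymbol s),t+\Delta t)=\widehat{\mathcal{L}}_b(\boldsymbol s,t)$ for all $t,\Delta t\ge0$, odd $m$ and $-t\le s_1\le\dots\le s_m\le t$; 3. for all $i,j\in\{-1,1\}$ and $t,\Delta t\ge0$, $$\widehat{\mathscr{K}}_{ij}(-t-\Delta t,t+\Delta t)=\sum_{k,l\in\{-1,1\}}b^{ij}_{kl}\,\widehat{\mathscr{K}}_{kl}(-t,t)+\widehat{\mathscr{D}}^{\Delta t}_{ij}(t+\Delta t).$$ -/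

import Mathlib

open MeasureTheory Set
/-- The spin space with orthonormal basis `|-1⟩, |1⟩`, indexed by `ℤˣ = {-1, 1}`. -/
abbrev SpinSpace : Type := EuclideanSpace ℂ ℤˣ

/-- Operators on the spin space. -/
abbrev SpinOp : Type := SpinSpace →L[ℂ] SpinSpace

/-- The data of a spin-boson model. The spectral density `J` is a density with respect to a
reference measure `ν` on frequencies: `ν = volume` for a continuous bath with density `J`, a sum of
point masses for a bath with countably many oscillators. -/
structure SpinBoson where
  /-- energy difference between the two spin states -/
  ε : ℝ
  /-- frequency of spin flipping -/
  Δ : ℝ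
  /-- inverse temperature -/
  β : ℝ
  /-- spectral density -/
  J : ℝ → ℝ
  /-- reference measure for the spectral density -/
  ν : Measure ℝ
  /-- observable on the system -/
  Os : SpinOp

namespace SpinBoson

noncomputable section

/-- The basis state `|i⟩`. -/
def ket (i : ℤˣ) : SpinSpace := EuclideanSpace.single i 1

/-- The operator `|i⟩⟨j|`. -/
def ketBra (i j : ℤˣ) : SpinOp := InnerProductSpace.rankOne ℂ (ket i) (ket j)

/-- The Pauli matrix `σ_x = |-1⟩⟨1| + |1⟩⟨-1|`. -/
def pauliX : SpinOp := ketBra (-1) 1 + ketBra 1 (-1)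

/-- The Pauli matrix `σ_z = |1⟩⟨1| - |-1⟩⟨-1|`. -/
def pauliZ : SpinOp := ketBra 1 1 - ketBra (-1) (-1)

/-- The coupling operator `W_s = σ_z`. -/
def Ws : SpinOp := pauliZ

/-- The system Hamiltonian `H_s = ε σ_z + Δ σ_x`. -/
def Hs (P : SpinBoson) : SpinOp := (P.ε : ℂ) • pauliZ + (P.Δ : ℂ) • pauliX

/-- The exponential `exp(i x H_s)`. -/
def expH (P : SpinBoson) (x : ℝ) : SpinOp :=
  NormedSpace.exp ((Complex.I * (x : ℂ)) • P.Hs)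

/-! ### The bath -/

/-- Hyperbolic cotangent. -/
def coth (x : ℝ) : ℝ := Real.cosh x / Real.sinh x

/-- The two-point correlation `B(τ₁, τ₂)`, where `Δτ = |τ₁| - |τ₂|`. -/
def B (P : SpinBoson) (τ₁ τ₂ : ℝ) : ℂ :=
  (1 / (Real.pi : ℂ)) * ∫ ω in Ioi (0 : ℝ),
    (P.J ω : ℂ) * ((coth (P.β * ω / 2) * Real.cos (ω * (|τ₁| - |τ₂|)) : ℝ)
      - Complex.I * (Real.sin (ω * (|τ₁| - |τ₂|)) : ℝ)) ∂P.ν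

/-- The number of negative components of `s`. -/
def negCount {m : ℕ} (s : Fin m → ℝ) : ℕ := {i | s i < 0}.ncard

/-- `q` is a pairing of the index set: a set of pairs `(j, k)` with `j < k` such that every
index lies in exactly one pair. -/
def IsPairing {m : ℕ} (q : Finset (Fin m × Fin m)) : Prop :=
  (∀ p ∈ q, p.1 < p.2) ∧ ∀ k : Fin m, ∃! p, p ∈ q ∧ (k = p.1 ∨ k = p.2)

/-- The set of indices that occur in a set of pairs. -/
def nodes {m : ℕ} (q : Finset (Fin m × Fin m)) : Set (Fin m) :=
  {k | ∃ p ∈ q, k = p.1 ∨ k = p.2}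

/-- The pairing `q` of the time points `s₁ ≤ ⋯ ≤ s_m` is removed in the bold-thin-bold
resummation: some `q' ⊆ q` covers exactly a set `{n₁, …, n₂}` of consecutive indices that contains
no end point of the bold sections. With `ℓ - 1 = negCount s` and indices starting from `1`, the last
condition reads `n₁ < n₂ < ℓ - 1` or `ℓ < n₁ < n₂ < m`; below the elements of `Fin m` start
from `0`. -/
def IsRemoved {m : ℕ} (s : Fin m → ℝ) (q : Finset (Fin m × Fin m)) : Prop :=
  ∃ q' ⊆ q, ∃ n₁ n₂ : Fin m, n₁ < n₂ ∧ nodes q' = Set.Icc n₁ n₂ ∧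
    ((n₂ : ℕ) + 1 < negCount s ∨
      (negCount s + 1 < (n₁ : ℕ) + 1 ∧ (n₂ : ℕ) + 1 < m))

open Classical in
/-- The set `𝒬(s₁, …, s_m)` of all pairings (as sets of pairs of indices). -/
def pairings (m : ℕ) : Finset (Finset (Fin m × Fin m)) :=
  Finset.univ.filter IsPairing

open Classical in
/-- The set `𝒬̂(s₁, …, s_m)` of the pairings kept in the bold-thin-bold resummation. -/
def keptPairings {m : ℕ} (s : Fin m → ℝ) : Finset (Finset (Fin m × Fin m)) :=
  (pairings m).filter fun q => ¬ IsRemoved s q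

/-- The bath influence functional `ℒ_b(s₁, …, s_m)`; it vanishes for odd `m`, since then there is
no pairing. -/
def Lb (P : SpinBoson) {m : ℕ} (s : Fin m → ℝ) : ℂ :=
  ∑ q ∈ pairings m, ∏ p ∈ q, P.B (s p.1) (s p.2)

/-- The bath influence functional `ℒ̂_b(s₁, …, s_m)` of the bold-thin-bold method. -/
def LbHat (P : SpinBoson) {m : ℕ} (s : Fin m → ℝ) : ℂ :=
  ∑ q ∈ keptPairings s, ∏ p ∈ q, P.B (s p.1) (s p.2)

/-! ### Integration domains -/

/-- The simplex `a ≤ s₁ ≤ ⋯ ≤ s_m ≤ b`. -/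
def simplex (m : ℕ) (a b : ℝ) : Set (Fin m → ℝ) :=
  {s | Monotone s ∧ ∀ i, s i ∈ Set.Icc a b}

/-- The domain `T_τ^{(m)}` of the points of the simplex `-τ ≤ s ≤ τ` that have at least one
component with `|s_j| ≤ Δt`. -/
def newDomain (m : ℕ) (Δt τ : ℝ) : Set (Fin m → ℝ) :=
  {s | s ∈ simplex m (-τ) τ ∧ ∃ j, |s j| ≤ Δt}

/-- The map `ℐ_{Δt}` that moves every time point away from `0` by `Δt`. -/
def stretch (Δt : ℝ) {m : ℕ} (s : Fin m → ℝ) : Fin m → ℝ :=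
  fun k => if 0 ≤ s k then s k + Δt else s k - Δt

/-! ### Propagators -/

/-- `G(s_m, b) W G(s_{m-1}, s_m) W ⋯ W G(s₁, s₂) W G(a, s₁)`. -/
def pathProduct (G : ℝ → ℝ → SpinOp) (W : SpinOp) (a : ℝ) :
    (m : ℕ) → (Fin m → ℝ) → ℝ → SpinOp
  | 0, _, b => G a b
  | m + 1, s, b =>
      G (s (Fin.last m)) b * W * pathProduct G W a m (fun k => s k.castSucc) (s (Fin.last m))

/-- The bare propagator `G_s^{(0)}(a, b)`, `a ≤ b` (set to `0` for `b < a`). -/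
def bareG (P : SpinBoson) (a b : ℝ) : SpinOp :=
  if a ≤ b ∧ b < 0 then P.expH (-(b - a))
  else if 0 ≤ a ∧ a ≤ b then P.expH (-(a - b))
  else if a < 0 ∧ 0 ≤ b then P.expH b * P.Os * P.expH a
  else 0

/-- The system associated functional `𝒰^{(0)}(a, s, b)`. -/
def bareU (P : SpinBoson) (a : ℝ) {m : ℕ} (s : Fin m → ℝ) (b : ℝ) : SpinOp :=
  pathProduct P.bareG Ws a m s b

/-- `(-1)^{#{s < 0}} 𝒰^{(0)}(a, s, b) ℒ_b(s)`. -/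
def fullIntegrand (P : SpinBoson) (a b : ℝ) (m : ℕ) (s : Fin m → ℝ) : SpinOp :=
  ((-1 : ℂ) ^ negCount s * P.Lb s) • P.bareU a s b

/-- The term of order `m` of the Dyson series of the full propagator. -/
def fullTerm (P : SpinBoson) (a b : ℝ) (m : ℕ) : SpinOp :=
  Complex.I ^ m • ∫ s in simplex m a b, P.fullIntegrand a b m s

/-- The full (bold) propagator `G(a, b)`, `a ≤ b`: the sum of the Dyson series over
`m = 0` (the bare propagator) and `m = 2, 4, 6, …`. -/
def fullG (P : SpinBoson) (a b : ℝ) : SpinOp :=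
  P.bareG a b + ∑' n : ℕ, P.fullTerm a b (2 * n + 2)

/-- The basis `𝒢̂_{ij}(a, b)`, `a ≤ b`, of the bold-thin-bold propagator (set to `0` for `b < a`):
the full propagator on each side of `0`, and the thin line `e^{i b H_s} |i⟩⟨j| e^{i a H_s}`
across `0`. -/
def basisG (P : SpinBoson) (i j : ℤˣ) (a b : ℝ) : SpinOp :=
  if (a ≤ b ∧ b < 0) ∨ (0 ≤ a ∧ a ≤ b) then P.fullG a b
  else if a < 0 ∧ 0 ≤ b then P.expH b * ketBra i j * P.expH a
  else 0

/-- The basis `𝒰̂_{ij}(a, s, b)` of the system associated functional. -/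
def basisU (P : SpinBoson) (i j : ℤˣ) (a : ℝ) {m : ℕ} (s : Fin m → ℝ) (b : ℝ) : SpinOp :=
  pathProduct (P.basisG i j) Ws a m s b

/-! ### The basis series -/

/-- `(-1)^{#{s < 0}} 𝒰̂_{ij}(-t, s, t) ℒ̂_b(s₁, …, s_m, t)`. -/
def basisIntegrand (P : SpinBoson) (i j : ℤˣ) (t : ℝ) (m : ℕ) (s : Fin m → ℝ) : SpinOp :=
  ((-1 : ℂ) ^ negCount s * P.LbHat (Fin.snoc s t : Fin (m + 1) → ℝ)) • P.basisU i j (-t) s t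

/-- The term of order `m` of the series `𝒦̂_{ij}(-t, t)`. -/
def basisKTerm (P : SpinBoson) (i j : ℤˣ) (t : ℝ) (m : ℕ) : SpinOp :=
  Complex.I ^ (m + 1) • ∫ s in simplex m (-t) t, P.basisIntegrand i j t m s

/-- The basis series `𝒦̂_{ij}(-t, t)`, a sum over `m = 1, 3, 5, …`. -/
def basisK (P : SpinBoson) (i j : ℤˣ) (t : ℝ) : SpinOp :=
  ∑' n : ℕ, P.basisKTerm i j t (2 * n + 1)

/-- The term of order `m` of the series `𝒟̂_{ij}^{Δt}(τ)`. -/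
def basisDTerm (P : SpinBoson) (i j : ℤˣ) (Δt τ : ℝ) (m : ℕ) : SpinOp :=
  Complex.I ^ (m + 1) • ∫ s in newDomain m Δt τ, P.basisIntegrand i j τ m s

/-- The series `𝒟̂_{ij}^{Δt}(τ)`, a sum over `m = 1, 3, 5, …`. -/
def basisD (P : SpinBoson) (i j : ℤˣ) (Δt τ : ℝ) : SpinOp :=
  ∑' n : ℕ, P.basisDTerm i j Δt τ (2 * n + 1)

/-- The coefficients `b^{ij}_{kl} = ⟨k| e^{iΔt H_s} |i⟩⟨j| e^{-iΔt H_s} |l⟩`. -/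
def shiftCoeff (P : SpinBoson) (Δt : ℝ) (i j k l : ℤˣ) : ℂ :=
  inner ℂ (ket k) ((P.expH Δt * ketBra i j * P.expH (-Δt)) (ket l))

/-- Every operator on the spin space is a combination of the operators `|k⟩⟨l|`. -/
theorem eq_sum_ketBra (A : SpinOp) :
    A = ∑ k, ∑ l, inner ℂ (ket k) (A (ket l)) • ketBra k l := by
  ext x : 1
  have hx : x = ∑ l, inner ℂ (ket l) x • ket l := by
    simpa [ket] using ((EuclideanSpace.basisFun ℤˣ ℂ).sum_repr' x).symm
  have hA : ∀ l, A (ket l) = ∑ k, inner ℂ (ket k) (A (ket l)) • ket k := fun l => by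
    simpa [ket] using ((EuclideanSpace.basisFun ℤˣ ℂ).sum_repr' (A (ket l))).symm
  calc A x = ∑ l, inner ℂ (ket l) x • A (ket l) := by
        conv_lhs => rw [hx]
        simp only [map_sum, map_smul]
    _ = ∑ l, inner ℂ (ket l) x • ∑ k, inner ℂ (ket k) (A (ket l)) • ket k :=
        Finset.sum_congr rfl fun l _ => by rw [← hA l]
    _ = ∑ l, ∑ k, inner ℂ (ket k) (A (ket l)) • inner ℂ (ket l) x • ket k := by
        simp only [Finset.smul_sum, smul_smul, mul_comm]
    _ = _ := by
        rw [Finset.sum_comm]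
        simp [ketBra, InnerProductSpace.rankOne_apply]

theorem shiftCoeff_spec (P : SpinBoson) (Δt : ℝ) (i j : ℤˣ) :
    P.expH Δt * ketBra i j * P.expH (-Δt) =
      ∑ k, ∑ l, P.shiftCoeff Δt i j k l • ketBra k l :=
  eq_sum_ketBra _

end

end SpinBoson

namespace SpinBoson

/-! ### The two-point correlation is bounded and continuous -/

/-! Convergence. Since `coth ≥ 1` on the positive axis, the integrand of `B` is dominated by `2 |J
coth|` uniformly in the times, so `B` is bounded and continuous. Propagators are bounded on bounded
squares of times. A pairing of `2N` indices is an `N`-element set of pairs, which bounds the number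
of pairings by `(2N)^(2N) / N!`, while the simplex of dimension `m` has volume at most `V^m / m!`.
With `N = n + 1` and `m ≥ 2n + 1`, these combine to at most geometric growth divided by `n!`
(`pairing_factor_le`, `summable_majorant`). The same estimate bounds `G` on squares, and `G` is
jointly measurable, so it may serve as a propagator in the second series.

Shift invariance. `B` sees only `|τ₁| - |τ₂|`, and the bare propagator on one side of `0` only the
difference of its arguments. A translation that keeps all times on their side of `0` therefore
changes neither the integrand nor Lebesgue measure.

Recurrence. Stretching by `d` preserves the signs of the times and the differences of their absolute
values, hence the kept pairings and `LbHat`. Up to a null set it maps the simplex over `[-t, t]`,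
preserving measure, onto the part of the simplex over `[-t-d, t+d]` outside `newDomain`. For `t > 0`
a path has exactly one factor crossing `0`. All other factors are full propagators on one side and
do not change; the crossing factor has `|i⟩⟨j|` replaced by `e^{idH}|i⟩⟨j|e^{-idH}`, which expands
with the coefficients `b^{ij}_{kl}` (`pathProduct_basisG_stretch`). Integrating and summing over the
orders gives the recurrence, with `newDomain` contributing `basisD`. -/

theorem one_le_coth {x : ℝ} (hx : 0 < x) : 1 ≤ coth x := by
  unfold coth
  rw [one_le_div (Real.sinh_pos_iff.2 hx)]
  exact (Real.sinh_lt_cosh x).le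

/-- The integrand of the two-point correlation as a function of `Δτ` and `ω`. -/
noncomputable def corrIntegrand (P : SpinBoson) (x ω : ℝ) : ℂ :=
  (P.J ω : ℂ) * ((coth (P.β * ω / 2) * Real.cos (ω * x) : ℝ)
      - Complex.I * (Real.sin (ω * x) : ℝ))

theorem B_eq (P : SpinBoson) (τ₁ τ₂ : ℝ) :
    P.B τ₁ τ₂ = (1 / (Real.pi : ℂ)) * ∫ ω in Ioi (0 : ℝ), P.corrIntegrand (|τ₁| - |τ₂|) ω ∂P.ν :=
  rfl

theorem B_congr (P : SpinBoson) {a b c d : ℝ} (h : |a| - |b| = |c| - |d|) :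
    P.B a b = P.B c d := by
  rw [B_eq, B_eq, h]

/-- The factor 2 counts the cosine and the sine term; the latter is at most `1 ≤ coth`. -/
theorem norm_corrIntegrand_le (P : SpinBoson) (hβ : 0 < P.β) (x : ℝ) {ω : ℝ} (hω : 0 < ω) :
    ‖P.corrIntegrand x ω‖ ≤ 2 * ‖P.J ω * coth (P.β * ω / 2)‖ := by
  have hc : 1 ≤ coth (P.β * ω / 2) := one_le_coth (by positivity)
  have h1 : ‖((coth (P.β * ω / 2) * Real.cos (ω * x) : ℝ) : ℂ)‖ ≤ coth (P.β * ω / 2) := by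
    rw [Complex.norm_real, norm_mul, Real.norm_eq_abs, Real.norm_eq_abs,
      abs_of_nonneg (zero_le_one.trans hc)]
    exact mul_le_of_le_one_right (zero_le_one.trans hc) (Real.abs_cos_le_one _)
  have h2 : ‖Complex.I * ((Real.sin (ω * x) : ℝ) : ℂ)‖ ≤ coth (P.β * ω / 2) := by
    rw [norm_mul, Complex.norm_I, one_mul, Complex.norm_real]
    exact (Real.abs_sin_le_one _).trans hc
  have h3 := (norm_sub_le _ _).trans (add_le_add h1 h2)
  unfold corrIntegrand
  rw [norm_mul, norm_mul, Complex.norm_real, Real.norm_eq_abs (coth _),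
    abs_of_nonneg (zero_le_one.trans hc)]
  nlinarith [norm_nonneg (P.J ω)]

theorem measurable_coth : Measurable coth :=
  Real.measurable_cosh.div Real.measurable_sinh

theorem aestronglyMeasurable_corrIntegrand (P : SpinBoson) (hβ : 0 < P.β)
    (hJ : IntegrableOn (fun ω : ℝ => P.J ω * coth (P.β * ω / 2)) (Ioi 0) P.ν) (x : ℝ) :
    AEStronglyMeasurable (P.corrIntegrand x) (P.ν.restrict (Ioi 0)) := by
  have hc : Measurable fun ω : ℝ => coth (P.β * ω / 2) := measurable_coth.comp (by fun_prop)
  -- Only the product `J * coth` is assumed measurable; dividing by `coth ≥ 1` recovers `J`.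
  have hJm : AEMeasurable P.J (P.ν.restrict (Ioi 0)) := by
    refine (hJ.aestronglyMeasurable.aemeasurable.div hc.aemeasurable).congr ?_
    filter_upwards [ae_restrict_mem measurableSet_Ioi] with ω hω
    have h1 : 1 ≤ coth (P.β * ω / 2) := one_le_coth (by have := mem_Ioi.1 hω; positivity)
    simp only [Pi.div_apply]
    rw [mul_div_cancel_right₀ _ (by linarith)]
  refine AEMeasurable.aestronglyMeasurable (AEMeasurable.mul ?_ (Measurable.aemeasurable ?_))
  · exact Complex.measurable_ofReal.comp_aemeasurable hJm
  · fun_prop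

theorem continuous_corr (P : SpinBoson) (hβ : 0 < P.β)
    (hJ : IntegrableOn (fun ω : ℝ => P.J ω * coth (P.β * ω / 2)) (Ioi 0) P.ν) :
    Continuous fun x => ∫ ω in Ioi (0 : ℝ), P.corrIntegrand x ω ∂P.ν := by
  refine continuous_of_dominated (bound := fun ω => 2 * ‖P.J ω * coth (P.β * ω / 2)‖)
    (P.aestronglyMeasurable_corrIntegrand hβ hJ) (fun x => ?_) (hJ.norm.const_mul 2) ?_
  · filter_upwards [ae_restrict_mem measurableSet_Ioi] with ω hω
    exact P.norm_corrIntegrand_le hβ x hω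
  · refine Filter.Eventually.of_forall fun ω => ?_
    unfold corrIntegrand
    fun_prop

theorem continuous_B (P : SpinBoson) (hβ : 0 < P.β)
    (hJ : IntegrableOn (fun ω : ℝ => P.J ω * coth (P.β * ω / 2)) (Ioi 0) P.ν) :
    Continuous fun p : ℝ × ℝ => P.B p.1 p.2 := by
  simp only [B_eq]
  exact continuous_const.mul ((P.continuous_corr hβ hJ).comp (by fun_prop))

theorem exists_norm_B_le (P : SpinBoson) (hβ : 0 < P.β)
    (hJ : IntegrableOn (fun ω : ℝ => P.J ω * coth (P.β * ω / 2)) (Ioi 0) P.ν) :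
    ∃ C, 0 ≤ C ∧ ∀ x y, ‖P.B x y‖ ≤ C := by
  refine ⟨‖1 / (Real.pi : ℂ)‖ * ∫ ω in Ioi (0 : ℝ), 2 * ‖P.J ω * coth (P.β * ω / 2)‖ ∂P.ν,
    by positivity, fun x y => ?_⟩
  rw [B_eq, norm_mul]
  refine mul_le_mul_of_nonneg_left ?_ (norm_nonneg _)
  refine norm_integral_le_of_norm_le (hJ.norm.const_mul 2) ?_
  filter_upwards [ae_restrict_mem measurableSet_Ioi] with ω hω
  exact P.norm_corrIntegrand_le hβ _ hω

/-! ### Counting pairings -/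

/-- Double counting of incidences between indices and pairs: each index lies in one pair, each pair
contains two indices. -/
theorem IsPairing.two_mul_card {m : ℕ} {q : Finset (Fin m × Fin m)} (hq : IsPairing q) :
    2 * q.card = m := by
  classical
  have h := Finset.sum_card_bipartiteAbove_eq_sum_card_bipartiteBelow
    (s := (Finset.univ : Finset (Fin m))) (t := q) (fun k p => k = p.1 ∨ k = p.2)
  have h1 : ∀ k ∈ (Finset.univ : Finset (Fin m)),
      (Finset.bipartiteAbove (fun k p => k = p.1 ∨ k = p.2) q k).card = 1 := fun k _ => by
    obtain ⟨p, hp, hu⟩ := hq.2 k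
    rw [Finset.card_eq_one]
    refine ⟨p, Finset.ext fun x => ?_⟩
    simp only [Finset.mem_bipartiteAbove, Finset.mem_singleton]
    exact ⟨hu x, fun h => h ▸ hp⟩
  have h2 : ∀ p ∈ q, (Finset.bipartiteBelow (fun k p => k = p.1 ∨ k = p.2)
      (Finset.univ : Finset (Fin m)) p).card = 2 := fun p hp => by
    rw [Finset.card_eq_two]
    refine ⟨p.1, p.2, (hq.1 p hp).ne, Finset.ext fun x => ?_⟩
    simp [Finset.mem_bipartiteBelow]
  rw [Finset.sum_congr rfl h1, Finset.sum_congr rfl h2] at h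
  simp only [Finset.sum_const, Finset.card_univ, Fintype.card_fin, smul_eq_mul] at h
  omega

theorem mem_pairings {m : ℕ} {q : Finset (Fin m × Fin m)} : q ∈ pairings m ↔ IsPairing q := by
  classical
  simp [pairings]

/-- Crude count: a pairing is an `n`-element subset of the `(2n)^2` ordered pairs. The `n!` from the
binomial coefficient is what convergence needs. -/
theorem card_pairings_le (n : ℕ) :
    ((pairings (2 * n)).card : ℝ) ≤ (2 * n : ℝ) ^ (2 * n) / n.factorial := by
  have h : pairings (2 * n) ⊆ Finset.powersetCard n Finset.univ := fun q hq => by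
    rw [Finset.mem_powersetCard]
    exact ⟨Finset.subset_univ _, by have := (mem_pairings.1 hq).two_mul_card; omega⟩
  have h1 := Finset.card_le_card h
  rw [Finset.card_powersetCard] at h1
  simp only [Finset.card_univ, Fintype.card_prod, Fintype.card_fin] at h1
  calc ((pairings (2 * n)).card : ℝ) ≤ ((2 * n * (2 * n)).choose n : ℕ) := by exact_mod_cast h1
    _ ≤ ((2 * n * (2 * n) : ℕ) : ℝ) ^ n / n.factorial := Nat.choose_le_pow_div _ _
    _ = _ := by push_cast; rw [pow_mul, sq]

/-! ### The bath influence functionals: bounds and measurability -/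

theorem norm_sum_prod_B_le (P : SpinBoson) {C : ℝ} (hC : ∀ x y, ‖P.B x y‖ ≤ C)
    {n m : ℕ} (hm : m = 2 * n) {Q : Finset (Finset (Fin m × Fin m))} (hQ : Q ⊆ pairings m)
    (s : Fin m → ℝ) :
    ‖∑ q ∈ Q, ∏ p ∈ q, P.B (s p.1) (s p.2)‖ ≤ (2 * n : ℝ) ^ (2 * n) / n.factorial * C ^ n := by
  have hC0 : 0 ≤ C := (norm_nonneg _).trans (hC 0 0)
  subst hm
  calc ‖∑ q ∈ Q, ∏ p ∈ q, P.B (s p.1) (s p.2)‖ ≤ ∑ q ∈ Q, C ^ n := by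
        refine norm_sum_le_of_le _ fun q hq => ?_
        have hn : q.card = n := by have := (mem_pairings.1 (hQ hq)).two_mul_card; omega
        rw [norm_prod]
        refine (Finset.prod_le_prod (fun p _ => norm_nonneg _) fun p _ => hC _ _).trans_eq ?_
        rw [Finset.prod_const, hn]
    _ = Q.card * C ^ n := by simp
    _ ≤ _ := by
        refine mul_le_mul_of_nonneg_right (le_trans ?_ (card_pairings_le n)) (pow_nonneg hC0 _)
        exact_mod_cast Finset.card_le_card hQ

theorem norm_Lb_le (P : SpinBoson) {C : ℝ} (hC : ∀ x y, ‖P.B x y‖ ≤ C)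
    {n m : ℕ} (hm : m = 2 * n) (s : Fin m → ℝ) :
    ‖P.Lb s‖ ≤ (2 * n : ℝ) ^ (2 * n) / n.factorial * C ^ n :=
  P.norm_sum_prod_B_le hC hm subset_rfl s

theorem norm_LbHat_le (P : SpinBoson) {C : ℝ} (hC : ∀ x y, ‖P.B x y‖ ≤ C)
    {n m : ℕ} (hm : m = 2 * n) (s : Fin m → ℝ) :
    ‖P.LbHat s‖ ≤ (2 * n : ℝ) ^ (2 * n) / n.factorial * C ^ n := by
  classical
  exact P.norm_sum_prod_B_le hC hm (Finset.filter_subset _ _) s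

theorem measurable_prod_B (P : SpinBoson) (hB : Continuous fun p : ℝ × ℝ => P.B p.1 p.2)
    {m : ℕ} (q : Finset (Fin m × Fin m)) :
    Measurable fun s : Fin m → ℝ => ∏ p ∈ q, P.B (s p.1) (s p.2) := by
  refine Continuous.measurable (continuous_finsetProd _ fun p _ => ?_)
  exact hB.comp (f := fun s : Fin m → ℝ => (s p.1, s p.2)) (by fun_prop)

theorem measurable_Lb (P : SpinBoson) (hB : Continuous fun p : ℝ × ℝ => P.B p.1 p.2) (m : ℕ) :
    Measurable (P.Lb (m := m)) :=
  Finset.measurable_sum _ fun q _ => P.measurable_prod_B hB q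

theorem negCount_eq_sum {m : ℕ} (s : Fin m → ℝ) :
    negCount s = ∑ i, if s i < 0 then 1 else 0 := by
  classical
  rw [negCount, Set.ncard_eq_toFinset_card', ← Finset.card_filter]
  congr 1
  ext i
  simp

theorem measurable_negCount (m : ℕ) : Measurable (negCount (m := m)) := by
  have : (negCount (m := m)) = fun s => ∑ i, if s i < 0 then 1 else 0 := funext negCount_eq_sum
  rw [this]
  refine Finset.measurable_sum _ fun i _ => ?_
  exact Measurable.ite (measurableSet_lt (measurable_pi_apply i) measurable_const)
    measurable_const measurable_const

theorem mem_keptPairings {m : ℕ} {s : Fin m → ℝ} {q : Finset (Fin m × Fin m)} :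
    q ∈ keptPairings s ↔ q ∈ pairings m ∧ ¬ IsRemoved s q := by
  classical
  unfold keptPairings
  exact Finset.mem_filter

/-- `IsRemoved` reads `s` only through `negCount`. This gives both the measurability of `LbHat` and
its invariance under stretching. -/
theorem keptPairings_congr {m : ℕ} {s s' : Fin m → ℝ} (h : negCount s = negCount s') :
    keptPairings s = keptPairings s' := by
  have h' : IsRemoved s = IsRemoved s' := by
    funext q
    simp only [IsRemoved, h]
  ext q
  rw [mem_keptPairings, mem_keptPairings, h']

theorem measurableSet_isRemoved {m : ℕ} (q : Finset (Fin m × Fin m)) :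
    MeasurableSet {s : Fin m → ℝ | IsRemoved s q} :=
  measurable_negCount m (t := {k | ∃ q' ⊆ q, ∃ n₁ n₂ : Fin m, n₁ < n₂ ∧
    nodes q' = Set.Icc n₁ n₂ ∧ ((n₂ : ℕ) + 1 < k ∨
      (k + 1 < (n₁ : ℕ) + 1 ∧ (n₂ : ℕ) + 1 < m))}) (MeasurableSet.of_discrete)

theorem measurable_LbHat (P : SpinBoson) (hB : Continuous fun p : ℝ × ℝ => P.B p.1 p.2) (m : ℕ) :
    Measurable (P.LbHat (m := m)) := by
  classical
  have : (P.LbHat (m := m)) = fun s => ∑ q ∈ pairings m,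
      if ¬ IsRemoved s q then ∏ p ∈ q, P.B (s p.1) (s p.2) else 0 := by
    funext s
    rw [LbHat, keptPairings, Finset.sum_filter]
  rw [this]
  exact Finset.measurable_sum _ fun q _ =>
    Measurable.ite (measurableSet_isRemoved q).compl (P.measurable_prod_B hB q) measurable_const


/-! ### The simplex -/

/-- Closedness jointly in the end points is needed because these become variables: in slicing the
simplex, and in the measurability of `fullTerm` as a function of `(a, b)`. -/
theorem isClosed_simplex_graph (m : ℕ) :
    IsClosed {p : (ℝ × ℝ) × (Fin m → ℝ) | p.2 ∈ simplex m p.1.1 p.1.2} := by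
  have h : {p : (ℝ × ℝ) × (Fin m → ℝ) | p.2 ∈ simplex m p.1.1 p.1.2} =
      (⋂ i, ⋂ j, ⋂ _ : i ≤ j, {p | p.2 i ≤ p.2 j}) ∩
        ⋂ i, ({p | p.1.1 ≤ p.2 i} ∩ {p | p.2 i ≤ p.1.2}) := by
    ext p
    simp [simplex, Monotone]
  rw [h]
  refine IsClosed.inter ?_ (isClosed_iInter fun i => IsClosed.inter ?_ ?_)
  · refine isClosed_iInter fun i => isClosed_iInter fun j => isClosed_iInter fun _ => ?_
    exact isClosed_le (by fun_prop) (by fun_prop)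
  · exact isClosed_le (by fun_prop) (by fun_prop)
  · exact isClosed_le (by fun_prop) (by fun_prop)

theorem measurableSet_simplex (m : ℕ) (a b : ℝ) : MeasurableSet (simplex m a b) :=
  ((isClosed_simplex_graph m).preimage
    (f := fun s : Fin m → ℝ => ((a, b), s)) (by fun_prop)).measurableSet

theorem simplex_eq_empty {m : ℕ} {a b : ℝ} (hm : m ≠ 0) (h : b < a) : simplex m a b = ∅ := by
  have : NeZero m := ⟨hm⟩
  refine Set.eq_empty_of_forall_notMem fun s hs => ?_
  have := hs.2 0
  exact absurd (this.1.trans this.2) (not_le.2 h)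

theorem castSucc_mem_simplex {m : ℕ} {a b : ℝ} {s : Fin (m + 1) → ℝ}
    (hs : s ∈ simplex (m + 1) a b) :
    (fun k : Fin m => s k.castSucc) ∈ simplex m a (s (Fin.last m)) :=
  ⟨fun _ _ hij => hs.1 (Fin.castSucc_le_castSucc_iff.2 hij),
    fun _ => ⟨(hs.2 _).1, hs.1 (Fin.le_last _)⟩⟩

/-- Slice by the last component `x`: the remaining components lie in the simplex over `[a, x]`, and
`(x - a)^m / m!` integrates to the next case. -/
theorem volume_simplex_le (m : ℕ) (a b : ℝ) (hab : a ≤ b) :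
    volume (simplex m a b) ≤ ENNReal.ofReal ((b - a) ^ m / m.factorial) := by
  induction m generalizing b with
  | zero =>
    refine (measure_mono (Set.subset_univ _)).trans ?_
    simp [volume_pi]
  | succ m ih =>
    let e := MeasurableEquiv.piFinSuccAbove (fun _ : Fin (m + 1) => ℝ) (Fin.last m)
    have he : MeasurePreserving e volume volume := volume_preserving_piFinSuccAbove _ _
    let T : Set (ℝ × (Fin m → ℝ)) := {p | p.1 ∈ Icc a b ∧ p.2 ∈ simplex m a p.1}
    have hT : MeasurableSet T :=
      (measurableSet_Icc.preimage measurable_fst).inter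
        ((isClosed_simplex_graph m).preimage
          (f := fun p : ℝ × (Fin m → ℝ) => ((a, p.1), p.2)) (by fun_prop)).measurableSet
    have hsub : simplex (m + 1) a b ⊆ e ⁻¹' T := fun s hs => by
      refine ⟨hs.2 _, ?_⟩
      have h := castSucc_mem_simplex hs
      have h2 : (e s).2 = fun k : Fin m => s k.castSucc := by
        funext k
        change s ((Fin.last m).succAbove k) = _
        rw [Fin.succAbove_last]
      rw [h2]
      exact h
    have hint : IntegrableOn (fun x : ℝ => (x - a) ^ m / m.factorial) (Icc a b) :=
      (Continuous.continuousOn (by fun_prop)).integrableOn_Icc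
    calc volume (simplex (m + 1) a b) ≤ volume (e ⁻¹' T) := measure_mono hsub
      _ = volume T := he.measure_preimage hT.nullMeasurableSet
      _ = ∫⁻ x : ℝ, volume (Prod.mk x ⁻¹' T) := by
          rw [Measure.volume_eq_prod, Measure.prod_apply hT]
      _ ≤ ∫⁻ x in Icc a b, ENNReal.ofReal ((x - a) ^ m / m.factorial) := by
          rw [← lintegral_indicator measurableSet_Icc]
          refine lintegral_mono fun x => ?_
          by_cases hx : x ∈ Icc a b
          · rw [Set.indicator_of_mem hx]
            exact (measure_mono fun s (hs : (x, s) ∈ T) => hs.2).trans (ih x hx.1)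
          · have : Prod.mk x ⁻¹' T = ∅ := Set.eq_empty_of_forall_notMem fun s hs => hx hs.1
            rw [Set.indicator_of_notMem hx]
            simp [this]
      _ = ENNReal.ofReal (∫ x in Icc a b, (x - a) ^ m / m.factorial) := by
          rw [ofReal_integral_eq_lintegral_ofReal hint]
          filter_upwards [ae_restrict_mem measurableSet_Icc] with x hx
          have : 0 ≤ x - a := sub_nonneg.2 hx.1
          simp only [Pi.zero_apply]
          positivity
      _ = ENNReal.ofReal ((b - a) ^ (m + 1) / (m + 1).factorial) := by
          congr 1
          rw [integral_Icc_eq_integral_Ioc, ← intervalIntegral.integral_of_le hab,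
            intervalIntegral.integral_div,
            intervalIntegral.integral_comp_sub_right (fun x => x ^ m) a, integral_pow,
            Nat.factorial_succ]
          have : (m : ℝ) + 1 ≠ 0 := by positivity
          push_cast
          field_simp
          simp

theorem volume_simplex_lt_top (m : ℕ) (a b : ℝ) : volume (simplex m a b) < ⊤ := by
  refine lt_of_le_of_lt (measure_mono fun s hs => ?_)
    (isCompact_univ_pi fun _ : Fin m => isCompact_Icc (a := a) (b := b)).measure_lt_top
  exact fun i _ => hs.2 i

theorem volume_real_simplex_le (m : ℕ) (a b : ℝ) (hab : a ≤ b) :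
    volume.real (simplex m a b) ≤ (b - a) ^ m / m.factorial :=
  ENNReal.toReal_le_of_le_ofReal (by have := sub_nonneg.2 hab; positivity)
    (volume_simplex_le m a b hab)

theorem newDomain_subset_simplex (m : ℕ) (Δt τ : ℝ) :
    newDomain m Δt τ ⊆ simplex m (-τ) τ := fun _ hs => hs.1

/-! ### Products along a path -/

theorem norm_pathProduct_le {G : ℝ → ℝ → SpinOp} {W : SpinOp} {a b M : ℝ} {R : Set ℝ}
    (hG : ∀ x ∈ R, ∀ y ∈ R, ‖G x y‖ ≤ M) (ha : a ∈ R) (hb : b ∈ R)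
    {m : ℕ} {s : Fin m → ℝ} (hs : ∀ i, s i ∈ R) :
    ‖pathProduct G W a m s b‖ ≤ M * (‖W‖ * M) ^ m := by
  have hM : 0 ≤ M := (norm_nonneg _).trans (hG a ha a ha)
  induction m generalizing b with
  | zero => simpa [pathProduct] using hG a ha b hb
  | succ m ih =>
    rw [pathProduct]
    calc _ ≤ M * ‖W‖ * (M * (‖W‖ * M) ^ m) := by
          refine (norm_mul_le _ _).trans (mul_le_mul ((norm_mul_le _ _).trans ?_)
            (ih (hs _) fun i => hs _) (norm_nonneg _) (by positivity))
          exact mul_le_mul_of_nonneg_right (hG _ (hs _) _ hb) (norm_nonneg _)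
      _ = _ := by ring

/-- Consecutive times of a point of the simplex are ordered, so agreement of the propagators on
ordered pairs suffices. Used with `φ` a translation and with `φ` the stretching of negative times.
-/
theorem pathProduct_congr {G G' : ℝ → ℝ → SpinOp} {W : SpinOp} {a a' b b' : ℝ} {R : Set ℝ}
    {φ : ℝ → ℝ} (hG : ∀ x ∈ R, ∀ y ∈ R, x ≤ y → G' (φ x) (φ y) = G x y) (ha : a ∈ R) (hb : b ∈ R)
    (hab : a ≤ b) (ha' : a' = φ a) (hb' : b' = φ b)
    {m : ℕ} {s : Fin m → ℝ} (hs : ∀ i, s i ∈ R) (hs' : s ∈ simplex m a b) :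
    pathProduct G' W a' m (fun i => φ (s i)) b' = pathProduct G W a m s b := by
  subst ha' hb'
  induction m generalizing b with
  | zero => exact hG a ha b hb hab
  | succ m ih =>
    rw [pathProduct, pathProduct, hG _ (hs _) _ hb (hs'.2 _).2,
      ih (s := fun k => s k.castSucc) (hs _) (hs'.2 _).1 (fun i => hs _) (castSucc_mem_simplex hs')]

theorem stronglyMeasurable_pathProduct {G : ℝ → ℝ → SpinOp} {W : SpinOp}
    (hG : StronglyMeasurable (Function.uncurry G)) {α : Type*} [MeasurableSpace α]
    {a b : α → ℝ} (ha : Measurable a) (hb : Measurable b) {m : ℕ} {s : α → Fin m → ℝ}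
    (hs : Measurable s) :
    StronglyMeasurable fun x => pathProduct G W (a x) m (s x) (b x) := by
  induction m generalizing b with
  | zero => exact hG.comp_measurable (ha.prodMk hb)
  | succ m ih =>
    have hi : ∀ i, Measurable fun x => s x i := fun i => (measurable_pi_apply i).comp hs
    exact ((hG.comp_measurable ((hi _).prodMk hb)).mul stronglyMeasurable_const).mul
      (ih (hi _) (measurable_pi_lambda _ fun i => hi _))

/-! ### A summable majorant -/

theorem pow_self_le_exp_mul_factorial (n : ℕ) :
    (n : ℝ) ^ n ≤ Real.exp 1 ^ n * n.factorial := by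
  have h := Real.pow_div_factorial_le_exp (n : ℝ) (Nat.cast_nonneg n) n
  rw [div_le_iff₀ (by positivity)] at h
  rwa [← Real.exp_nat_mul, mul_one]

/-- With `N = n + 1`, `N^N ≤ e^N N!` turns `(2N)^(2N) / N!` into at most `(4e²)^N N!`, and `n! N! ≤
(2n + 1)!` leaves a factor `1 / n!`. -/
theorem pairing_factor_le (n : ℕ) :
    (2 * (n + 1 : ℕ) : ℝ) ^ (2 * (n + 1)) / (n + 1).factorial / (2 * n + 1).factorial ≤
      (4 * Real.exp 1 ^ 2) ^ (n + 1) / n.factorial := by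
  have h1 := pow_self_le_exp_mul_factorial (n + 1)
  have h2 : (n.factorial * (n + 1).factorial : ℝ) ≤ (2 * n + 1).factorial := by
    have h := Nat.le_of_dvd (Nat.factorial_pos _)
      (Nat.factorial_mul_factorial_dvd_factorial_add n (n + 1))
    rw [show n + (n + 1) = 2 * n + 1 by ring] at h
    exact_mod_cast h
  have h3 : (2 * (n + 1 : ℕ) : ℝ) ^ (2 * (n + 1)) =
      4 ^ (n + 1) * (((n + 1 : ℕ) : ℝ) ^ (n + 1)) ^ 2 := by
    rw [mul_pow, pow_mul, ← pow_mul _ (n + 1) 2, mul_comm 2 (n + 1)]; norm_num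
  rw [h3, div_div, div_le_div_iff₀ (by positivity) (by positivity)]
  calc 4 ^ (n + 1) * (((n + 1 : ℕ) : ℝ) ^ (n + 1)) ^ 2 * n.factorial
      ≤ 4 ^ (n + 1) * (Real.exp 1 ^ (n + 1) * (n + 1).factorial) ^ 2 * n.factorial := by gcongr
    _ = (4 * Real.exp 1 ^ 2) ^ (n + 1) * ((n + 1).factorial * (n.factorial * (n + 1).factorial)) := by
        rw [mul_pow, mul_pow, ← pow_mul, ← pow_mul, mul_comm 2 (n + 1)]; ring
    _ ≤ _ := by gcongr

/-- The summable majorant of the Dyson series: `C` bounds the correlation function, `M` the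
propagators, `w` the coupling and `V` the length of the time interval. -/
noncomputable def majorant (C M w V : ℝ) (n : ℕ) : ℝ :=
  (4 * Real.exp 1 ^ 2) ^ (n + 1) / n.factorial * (C ^ (n + 1) * M * (w * M * V) ^ (2 * n + 1))

theorem summable_majorant (C M w V : ℝ) : Summable (majorant C M w V) := by
  -- Up to a constant factor the majorant is the exponential series at `4e² C (wMV)²`.
  have h := (Real.summable_pow_div_factorial (4 * Real.exp 1 ^ 2 * C * (w * M * V) ^ 2)).mul_left
    (4 * Real.exp 1 ^ 2 * C * M * (w * M * V))
  refine h.congr fun n => ?_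
  unfold majorant
  rw [mul_pow, mul_pow, ← pow_mul]
  ring

theorem norm_setIntegral_simplex_le {m : ℕ} {S : Set (Fin m → ℝ)} {f : (Fin m → ℝ) → SpinOp}
    {a b K V : ℝ} (hab : a ≤ b) (hV : b - a ≤ V) (hS : S ⊆ simplex m a b)
    (hf : ∀ s ∈ simplex m a b, ‖f s‖ ≤ K) (hK : 0 ≤ K) :
    ‖∫ s in S, f s‖ ≤ K * (V ^ m / m.factorial) := by
  refine (norm_setIntegral_le_of_norm_le_const
    ((measure_mono hS).trans_lt (volume_simplex_lt_top m a b)) fun s hs => hf s (hS hs)).trans ?_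
  refine mul_le_mul_of_nonneg_left ?_ hK
  refine ((measureReal_mono hS (volume_simplex_lt_top m a b).ne).trans
    (volume_real_simplex_le m a b hab)).trans ?_
  have := sub_nonneg.2 hab
  gcongr


/-! ### The bare propagator -/

theorem continuous_expH (P : SpinBoson) : Continuous P.expH := by
  let _ : NormedAlgebra ℚ SpinOp := NormedAlgebra.restrictScalars ℚ ℂ SpinOp
  unfold expH
  exact NormedSpace.exp_continuous.comp (by fun_prop)

theorem expH_add (P : SpinBoson) (x y : ℝ) : P.expH (x + y) = P.expH x * P.expH y := by
  let _ : NormedAlgebra ℚ SpinOp := NormedAlgebra.restrictScalars ℚ ℂ SpinOp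
  have h : (Complex.I * ((x + y : ℝ) : ℂ)) • P.Hs =
      (Complex.I * (x : ℂ)) • P.Hs + (Complex.I * (y : ℂ)) • P.Hs := by
    push_cast
    rw [mul_add]
    exact add_smul (Complex.I * (x : ℂ)) (Complex.I * (y : ℂ)) P.Hs
  rw [expH, h]
  exact NormedSpace.exp_add_of_commute (((Commute.refl P.Hs).smul_left _).smul_right _)

theorem exists_norm_expH_le (P : SpinBoson) (R : ℝ) :
    ∃ M, 1 ≤ M ∧ ∀ x, |x| ≤ R → ‖P.expH x‖ ≤ M := by
  obtain ⟨M, hM⟩ := (isCompact_Icc (a := -R) (b := R)).exists_bound_of_continuousOn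
    P.continuous_expH.continuousOn
  exact ⟨max M 1, le_max_right _ _, fun x hx => (hM x (abs_le.1 hx)).trans (le_max_left _ _)⟩

theorem exists_norm_bareG_le (P : SpinBoson) (R : ℝ) :
    ∃ M, 0 ≤ M ∧ ∀ x ∈ Icc (-R) R, ∀ y ∈ Icc (-R) R, ‖P.bareG x y‖ ≤ M := by
  obtain ⟨M, hM1, hM⟩ := P.exists_norm_expH_le (2 * R)
  have hM0 : 0 ≤ M := zero_le_one.trans hM1
  refine ⟨max M (M * ‖P.Os‖ * M), le_max_of_le_left hM0, fun x hx y hy => ?_⟩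
  have h1 := hx.1
  have h2 := hx.2
  have h3 := hy.1
  have h4 := hy.2
  unfold bareG
  split_ifs
  · exact (hM _ (abs_le.2 ⟨by linarith, by linarith⟩)).trans (le_max_left _ _)
  · exact (hM _ (abs_le.2 ⟨by linarith, by linarith⟩)).trans (le_max_left _ _)
  · refine le_trans ?_ (le_max_right _ _)
    refine (norm_mul_le _ _).trans (mul_le_mul ((norm_mul_le _ _).trans ?_)
      (hM _ (abs_le.2 ⟨by linarith, by linarith⟩)) (norm_nonneg _) (by positivity))
    exact mul_le_mul_of_nonneg_right (hM _ (abs_le.2 ⟨by linarith, by linarith⟩)) (norm_nonneg _)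
  · rw [norm_zero]
    exact le_max_of_le_left hM0

theorem stronglyMeasurable_expH_mul_expH (P : SpinBoson) (A : SpinOp) :
    StronglyMeasurable fun p : ℝ × ℝ => P.expH p.2 * A * P.expH p.1 :=
  (((P.continuous_expH.comp continuous_snd).mul continuous_const).mul
    (P.continuous_expH.comp continuous_fst)).stronglyMeasurable

theorem measurableSet_crossing : MeasurableSet {p : ℝ × ℝ | p.1 < 0 ∧ 0 ≤ p.2} :=
  (measurableSet_lt measurable_fst measurable_const).inter
    (measurableSet_le measurable_const measurable_snd)

theorem measurableSet_left : MeasurableSet {p : ℝ × ℝ | p.1 ≤ p.2 ∧ p.2 < 0} :=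
  (measurableSet_le measurable_fst measurable_snd).inter
    (measurableSet_lt measurable_snd measurable_const)

theorem measurableSet_right : MeasurableSet {p : ℝ × ℝ | 0 ≤ p.1 ∧ p.1 ≤ p.2} :=
  (measurableSet_le measurable_const measurable_fst).inter
    (measurableSet_le measurable_fst measurable_snd)

theorem stronglyMeasurable_bareG (P : SpinBoson) :
    StronglyMeasurable (Function.uncurry P.bareG) := by
  unfold Function.uncurry bareG
  refine StronglyMeasurable.ite measurableSet_left ?_
    (StronglyMeasurable.ite measurableSet_right ?_
      (StronglyMeasurable.ite measurableSet_crossing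
        (P.stronglyMeasurable_expH_mul_expH _) stronglyMeasurable_const))
  · exact (P.continuous_expH.comp (by fun_prop)).stronglyMeasurable
  · exact (P.continuous_expH.comp (by fun_prop)).stronglyMeasurable

theorem bareG_add (P : SpinBoson) {x y d : ℝ} (hxy : x ≤ y) (hd : 0 ≤ d)
    (h : y + d < 0 ∨ 0 ≤ x) : P.bareG (x + d) (y + d) = P.bareG x y := by
  unfold bareG
  rcases h with h | h
  · rw [if_pos ⟨by linarith, h⟩, if_pos ⟨hxy, by linarith⟩]
    congr 1
    ring
  · rw [if_neg (fun h' => by linarith [h'.2]), if_pos ⟨by linarith, by linarith⟩,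
      if_neg (fun h' => by linarith [h'.2]), if_pos ⟨h, hxy⟩]
    congr 1
    ring

/-! ### The full propagator: convergence -/

theorem norm_neg_one_pow_mul (k : ℕ) (z : ℂ) : ‖(-1 : ℂ) ^ k * z‖ = ‖z‖ := by
  rw [norm_mul, norm_pow, norm_neg, norm_one, one_pow, one_mul]

theorem norm_fullIntegrand_le (P : SpinBoson) {C M : ℝ} {R : Set ℝ} (hC : ∀ x y, ‖P.B x y‖ ≤ C)
    (hM : ∀ x ∈ R, ∀ y ∈ R, ‖P.bareG x y‖ ≤ M) {a b : ℝ} (ha : a ∈ R) (hb : b ∈ R) (n : ℕ)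
    {s : Fin (2 * n + 2) → ℝ} (hs : ∀ i, s i ∈ R) :
    ‖P.fullIntegrand a b (2 * n + 2) s‖ ≤
      (2 * (n + 1 : ℕ) : ℝ) ^ (2 * (n + 1)) / (n + 1).factorial * C ^ (n + 1) *
        (M * (‖Ws‖ * M) ^ (2 * n + 2)) := by
  rw [fullIntegrand, norm_smul, norm_neg_one_pow_mul]
  have h1 := P.norm_Lb_le hC (n := n + 1) (by ring) s
  exact mul_le_mul h1 (norm_pathProduct_le hM ha hb hs) (norm_nonneg _)
    ((norm_nonneg _).trans h1)

theorem norm_fullTerm_le (P : SpinBoson) {C M R : ℝ} (hC : ∀ x y, ‖P.B x y‖ ≤ C)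
    (hM : ∀ x ∈ Icc (-R) R, ∀ y ∈ Icc (-R) R, ‖P.bareG x y‖ ≤ M)
    {a b : ℝ} (ha : a ∈ Icc (-R) R) (hb : b ∈ Icc (-R) R) (n : ℕ) :
    ‖P.fullTerm a b (2 * n + 2)‖ ≤
      ‖Ws‖ * M * (2 * R) * majorant C M ‖Ws‖ (2 * R) n := by
  have hC0 : 0 ≤ C := (norm_nonneg _).trans (hC 0 0)
  have hM0 : 0 ≤ M := (norm_nonneg _).trans (hM a ha a ha)
  have hR : 0 ≤ R := by linarith [ha.1, ha.2]
  rw [fullTerm, norm_smul, norm_pow, Complex.norm_I, one_pow, one_mul]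
  -- Unordered end points are included so that the bound holds on a whole square, as
  -- `norm_pathProduct_le` requires of a propagator.
  rcases lt_or_ge b a with hab | hab
  · rw [simplex_eq_empty (by omega) hab]
    simp only [Measure.restrict_empty, integral_zero_measure, norm_zero]
    unfold majorant
    positivity
  have hV : b - a ≤ 2 * R := by linarith [ha.1, hb.2]
  have hb' := norm_setIntegral_simplex_le hab hV (subset_refl (simplex (2 * n + 2) a b))
    (fun s hs => P.norm_fullIntegrand_le hC hM ha hb n fun i =>
      ⟨ha.1.trans (hs.2 i).1, (hs.2 i).2.trans hb.2⟩) (by positivity)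
  refine hb'.trans ?_
  -- Weakening `(2n + 2)!` to `(2n + 1)!` lets the majorant of the odd orders serve here too, at the
  -- price of one extra factor `‖Ws‖ * M * (2 * R)`.
  have hfac : ((2 * n + 1).factorial : ℝ) ≤ (2 * n + 2).factorial := by
    exact_mod_cast Nat.factorial_le (by omega)
  calc _ ≤ (2 * (n + 1 : ℕ) : ℝ) ^ (2 * (n + 1)) / (n + 1).factorial * C ^ (n + 1) *
        (M * (‖Ws‖ * M) ^ (2 * n + 2)) * ((2 * R) ^ (2 * n + 2) / (2 * n + 1).factorial) := by
        gcongr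
    _ = (2 * (n + 1 : ℕ) : ℝ) ^ (2 * (n + 1)) / (n + 1).factorial / (2 * n + 1).factorial *
        (‖Ws‖ * M * (2 * R) * (C ^ (n + 1) * M * (‖Ws‖ * M * (2 * R)) ^ (2 * n + 1))) := by
        ring
    _ ≤ (4 * Real.exp 1 ^ 2) ^ (n + 1) / n.factorial *
        (‖Ws‖ * M * (2 * R) * (C ^ (n + 1) * M * (‖Ws‖ * M * (2 * R)) ^ (2 * n + 1))) :=
        mul_le_mul_of_nonneg_right (pairing_factor_le n) (by positivity)
    _ = _ := by unfold majorant; ring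

theorem stronglyMeasurable_fullIntegrand (P : SpinBoson)
    (hB : Continuous fun p : ℝ × ℝ => P.B p.1 p.2) (m : ℕ) :
    StronglyMeasurable fun p : (ℝ × ℝ) × (Fin m → ℝ) => P.fullIntegrand p.1.1 p.1.2 m p.2 := by
  have hc : Measurable fun p : (ℝ × ℝ) × (Fin m → ℝ) =>
      (-1 : ℂ) ^ negCount p.2 * P.Lb p.2 :=
    ((measurable_of_countable fun k : ℕ => (-1 : ℂ) ^ k).comp
      ((measurable_negCount m).comp measurable_snd)).mul
        ((P.measurable_Lb hB m).comp measurable_snd)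
  exact hc.stronglyMeasurable.smul (stronglyMeasurable_pathProduct P.stronglyMeasurable_bareG
    (a := fun p : (ℝ × ℝ) × (Fin m → ℝ) => p.1.1) (b := fun p => p.1.2)
    (by fun_prop) (by fun_prop) measurable_snd)

theorem integrableOn_fullIntegrand (P : SpinBoson) (hβ : 0 < P.β)
    (hJ : IntegrableOn (fun ω : ℝ => P.J ω * coth (P.β * ω / 2)) (Ioi 0) P.ν)
    (a b : ℝ) (n : ℕ) :
    IntegrableOn (P.fullIntegrand a b (2 * n + 2)) (simplex (2 * n + 2) a b) := by
  obtain ⟨C, _, hC⟩ := P.exists_norm_B_le hβ hJ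
  obtain ⟨M, _, hM⟩ := P.exists_norm_bareG_le (max |a| |b|)
  have ha : a ∈ Icc (-(max |a| |b|)) (max |a| |b|) := abs_le.1 (le_max_left _ _)
  have hb : b ∈ Icc (-(max |a| |b|)) (max |a| |b|) := abs_le.1 (le_max_right _ _)
  have hbound := fun s (hs : s ∈ simplex (2 * n + 2) a b) =>
    P.norm_fullIntegrand_le hC hM ha hb n fun i =>
      ⟨ha.1.trans (hs.2 i).1, (hs.2 i).2.trans hb.2⟩
  exact Measure.integrableOn_of_bounded (volume_simplex_lt_top _ _ _).ne
    ((P.stronglyMeasurable_fullIntegrand (P.continuous_B hβ hJ) _).comp_measurable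
      (g := fun s => ((a, b), s)) (by fun_prop)).aestronglyMeasurable
    ((ae_restrict_mem (measurableSet_simplex _ _ _)).mono hbound)

theorem summable_norm_fullTerm (P : SpinBoson) (hβ : 0 < P.β)
    (hJ : IntegrableOn (fun ω : ℝ => P.J ω * coth (P.β * ω / 2)) (Ioi 0) P.ν) (a b : ℝ) :
    Summable fun n : ℕ => ‖P.fullTerm a b (2 * n + 2)‖ := by
  obtain ⟨C, _, hC⟩ := P.exists_norm_B_le hβ hJ
  obtain ⟨M, _, hM⟩ := P.exists_norm_bareG_le (max |a| |b|)
  exact Summable.of_nonneg_of_le (fun n => norm_nonneg _)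
    (fun n => P.norm_fullTerm_le hC hM (abs_le.1 (le_max_left _ _)) (abs_le.1 (le_max_right _ _)) n)
    ((summable_majorant _ _ _ _).mul_left _)

theorem exists_norm_fullG_le (P : SpinBoson) (hβ : 0 < P.β)
    (hJ : IntegrableOn (fun ω : ℝ => P.J ω * coth (P.β * ω / 2)) (Ioi 0) P.ν) (R : ℝ) :
    ∃ M, 0 ≤ M ∧ ∀ x ∈ Icc (-R) R, ∀ y ∈ Icc (-R) R, ‖P.fullG x y‖ ≤ M := by
  obtain ⟨C, _, hC⟩ := P.exists_norm_B_le hβ hJ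
  obtain ⟨M, hM0, hM⟩ := P.exists_norm_bareG_le R
  have hs := (summable_majorant C M ‖Ws‖ (2 * R)).mul_left (‖Ws‖ * M * (2 * R))
  refine ⟨max 0 (M + ∑' n, ‖Ws‖ * M * (2 * R) * majorant C M ‖Ws‖ (2 * R) n), le_max_left _ _,
    fun x hx y hy => le_max_of_le_right ?_⟩
  exact (norm_add_le _ _).trans (add_le_add (hM x hx y hy)
    (tsum_of_norm_bounded hs.hasSum fun n => P.norm_fullTerm_le hC hM hx hy n))

/-- The domain of integration depends on the end points; an indicator of the closed graph of the
simplex turns it into a parameter integral over a fixed space. -/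
theorem stronglyMeasurable_fullTerm (P : SpinBoson)
    (hB : Continuous fun p : ℝ × ℝ => P.B p.1 p.2) (m : ℕ) :
    StronglyMeasurable fun p : ℝ × ℝ => P.fullTerm p.1 p.2 m := by
  have h : (fun p : ℝ × ℝ => P.fullTerm p.1 p.2 m) = fun p : ℝ × ℝ => Complex.I ^ m •
      ∫ s, {q : (ℝ × ℝ) × (Fin m → ℝ) | q.2 ∈ simplex m q.1.1 q.1.2}.indicator
        (fun q => P.fullIntegrand q.1.1 q.1.2 m q.2) (p, s) := by
    funext p
    rw [fullTerm, ← integral_indicator (measurableSet_simplex _ _ _)]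
    rfl
  rw [h]
  have hm := (P.stronglyMeasurable_fullIntegrand hB m).indicator
    (isClosed_simplex_graph m).measurableSet
  exact (StronglyMeasurable.integral_prod_right (ν := volume) (f := fun p s => indicator
    {q : (ℝ × ℝ) × (Fin m → ℝ) | q.2 ∈ simplex m q.1.1 q.1.2}
      (fun q => P.fullIntegrand q.1.1 q.1.2 m q.2) (p, s)) hm).const_smul (Complex.I ^ m)

theorem stronglyMeasurable_fullG (P : SpinBoson) (hβ : 0 < P.β)
    (hJ : IntegrableOn (fun ω : ℝ => P.J ω * coth (P.β * ω / 2)) (Ioi 0) P.ν) :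
    StronglyMeasurable fun p : ℝ × ℝ => P.fullG p.1 p.2 := by
  refine P.stronglyMeasurable_bareG.add ?_
  refine stronglyMeasurable_of_tendsto Filter.atTop
    (f := fun N : ℕ => ∑ n ∈ Finset.range N, fun p : ℝ × ℝ => P.fullTerm p.1 p.2 (2 * n + 2))
    (fun N => Finset.stronglyMeasurable_sum _ fun n _ =>
      P.stronglyMeasurable_fullTerm (P.continuous_B hβ hJ) _) ?_
  rw [tendsto_pi_nhds]
  intro p
  simp only [Finset.sum_apply]
  exact (P.summable_norm_fullTerm hβ hJ p.1 p.2).of_norm.hasSum.tendsto_sum_nat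

/-! ### The full propagator: shift invariance -/

/-- All times stay on one side of `0`, so their absolute values change by the same amount and the
differences entering `B` persist. -/
theorem fullIntegrand_add (P : SpinBoson) {a b d : ℝ} (hab : a ≤ b) (hd : 0 ≤ d)
    (h : b + d < 0 ∨ 0 ≤ a) {m : ℕ} {s : Fin m → ℝ} (hs : s ∈ simplex m a b) :
    P.fullIntegrand (a + d) (b + d) m (fun i => s i + d) = P.fullIntegrand a b m s := by
  have hn : negCount (fun i => s i + d) = negCount s := by
    unfold negCount
    congr 1
    ext i
    have := (hs.2 i).1
    have := (hs.2 i).2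
    simp only [Set.mem_ofPred_eq]
    rcases h with h | h <;> constructor <;> intro <;> linarith
  have hL : P.Lb (fun i => s i + d) = P.Lb s := by
    refine Finset.sum_congr rfl fun q _ => Finset.prod_congr rfl fun p _ => P.B_congr ?_
    have h1 := hs.2 p.1
    have h2 := hs.2 p.2
    rcases h with h | h
    · rw [abs_of_neg (by linarith [h1.2]), abs_of_neg (by linarith [h2.2]),
        abs_of_neg (by linarith [h1.2]), abs_of_neg (by linarith [h2.2])]
      ring
    · rw [abs_of_nonneg (by linarith [h1.1]), abs_of_nonneg (by linarith [h2.1]),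
        abs_of_nonneg (by linarith [h1.1]), abs_of_nonneg (by linarith [h2.1])]
      ring
  have hU : P.bareU (a + d) (fun i => s i + d) (b + d) = P.bareU a s b :=
    pathProduct_congr (R := Icc a b) (φ := fun x => x + d)
      (fun x hx y hy hxy => P.bareG_add hxy hd
        (h.imp (fun h => by linarith [hy.2]) fun h => h.trans hx.1))
      (left_mem_Icc.2 hab) (right_mem_Icc.2 hab) hab rfl rfl hs.2 hs
  rw [fullIntegrand, fullIntegrand, hn, hL, hU]

theorem add_mem_simplex_iff {m : ℕ} {a b d : ℝ} {s : Fin m → ℝ} :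
    (fun i => s i + d) ∈ simplex m (a + d) (b + d) ↔ s ∈ simplex m a b := by
  simp [simplex, Monotone]

theorem fullTerm_add (P : SpinBoson) {a b d : ℝ} (hab : a ≤ b) (hd : 0 ≤ d)
    (h : b + d < 0 ∨ 0 ≤ a) (m : ℕ) : P.fullTerm (a + d) (b + d) m = P.fullTerm a b m := by
  rw [fullTerm, fullTerm, ← integral_indicator (measurableSet_simplex _ _ _),
    ← integral_indicator (measurableSet_simplex _ _ _),
    ← integral_add_right_eq_self _ (fun _ : Fin m => d)]
  congr 2
  funext s
  change (simplex m (a + d) (b + d)).indicator _ (fun i => s i + d) = _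
  by_cases hs : s ∈ simplex m a b
  · rw [Set.indicator_of_mem hs, Set.indicator_of_mem (add_mem_simplex_iff.2 hs),
      P.fullIntegrand_add hab hd h hs]
  · rw [Set.indicator_of_notMem hs, Set.indicator_of_notMem (mt add_mem_simplex_iff.1 hs)]

theorem fullG_add (P : SpinBoson) {a b d : ℝ} (hab : a ≤ b) (hd : 0 ≤ d)
    (h : b + d < 0 ∨ 0 ≤ a) : P.fullG (a + d) (b + d) = P.fullG a b := by
  rw [fullG, fullG, P.bareG_add hab hd h]
  simp only [P.fullTerm_add hab hd h]


/-! ### Stretching the time points away from `0` -/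

theorem stretch_neg_iff {d : ℝ} (hd : 0 ≤ d) {m : ℕ} (s : Fin m → ℝ) (k : Fin m) :
    stretch d s k < 0 ↔ s k < 0 := by
  unfold stretch
  split_ifs with h <;> constructor <;> intro <;> linarith

theorem abs_stretch {d : ℝ} (hd : 0 ≤ d) {m : ℕ} (s : Fin m → ℝ) (k : Fin m) :
    |stretch d s k| = |s k| + d := by
  unfold stretch
  split_ifs with h
  · rw [abs_of_nonneg h, abs_of_nonneg (by linarith)]
  · rw [abs_of_neg (by linarith), abs_of_neg (by linarith)]
    ring

theorem negCount_stretch {d : ℝ} (hd : 0 ≤ d) {m : ℕ} (s : Fin m → ℝ) :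
    negCount (stretch d s) = negCount s := by
  simp only [negCount, stretch_neg_iff hd]

theorem LbHat_stretch (P : SpinBoson) {d : ℝ} (hd : 0 ≤ d) {m : ℕ} (s : Fin m → ℝ) :
    P.LbHat (stretch d s) = P.LbHat s := by
  rw [LbHat, LbHat, keptPairings_congr (negCount_stretch hd s)]
  refine Finset.sum_congr rfl fun q _ => Finset.prod_congr rfl fun p _ => P.B_congr ?_
  rw [abs_stretch hd, abs_stretch hd]
  ring

/-- The end time is nonnegative, so it is stretched like any other time. -/
theorem snoc_stretch {t : ℝ} (ht : 0 ≤ t) (d : ℝ) {m : ℕ} (s : Fin m → ℝ) :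
    (Fin.snoc (stretch d s) (t + d) : Fin (m + 1) → ℝ) =
      stretch d (Fin.snoc s t : Fin (m + 1) → ℝ) := by
  funext k
  refine Fin.lastCases ?_ (fun k => ?_) k
  · simp [stretch, ht]
  · simp [stretch]

theorem LbHat_snoc_stretch (P : SpinBoson) {t d : ℝ} (ht : 0 ≤ t) (hd : 0 ≤ d) {m : ℕ}
    (s : Fin m → ℝ) :
    P.LbHat (Fin.snoc (stretch d s) (t + d) : Fin (m + 1) → ℝ) =
      P.LbHat (Fin.snoc s t : Fin (m + 1) → ℝ) := by
  rw [snoc_stretch ht, P.LbHat_stretch hd]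

/-! ### The basis series: convergence -/

theorem exists_norm_basisG_le (P : SpinBoson) (hβ : 0 < P.β)
    (hJ : IntegrableOn (fun ω : ℝ => P.J ω * coth (P.β * ω / 2)) (Ioi 0) P.ν) (i j : ℤˣ) (R : ℝ) :
    ∃ M, 0 ≤ M ∧ ∀ x ∈ Icc (-R) R, ∀ y ∈ Icc (-R) R, ‖P.basisG i j x y‖ ≤ M := by
  obtain ⟨M, hM1, hM⟩ := P.exists_norm_expH_le R
  obtain ⟨N, hN0, hN⟩ := P.exists_norm_fullG_le hβ hJ R
  have hM0 : 0 ≤ M := zero_le_one.trans hM1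
  refine ⟨max N (M * ‖ketBra i j‖ * M), le_max_of_le_left hN0, fun x hx y hy => ?_⟩
  unfold basisG
  split_ifs
  · exact (hN x hx y hy).trans (le_max_left _ _)
  · refine le_trans ?_ (le_max_right _ _)
    refine (norm_mul_le _ _).trans (mul_le_mul ((norm_mul_le _ _).trans ?_)
      (hM _ (abs_le.2 hx)) (norm_nonneg _) (by positivity))
    exact mul_le_mul_of_nonneg_right (hM _ (abs_le.2 hy)) (norm_nonneg _)
  · rw [norm_zero]
    exact le_max_of_le_left hN0

theorem stronglyMeasurable_basisG (P : SpinBoson) (hβ : 0 < P.β)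
    (hJ : IntegrableOn (fun ω : ℝ => P.J ω * coth (P.β * ω / 2)) (Ioi 0) P.ν) (i j : ℤˣ) :
    StronglyMeasurable (Function.uncurry (P.basisG i j)) := by
  unfold Function.uncurry basisG
  exact StronglyMeasurable.ite (measurableSet_left.union measurableSet_right)
    (P.stronglyMeasurable_fullG hβ hJ)
    (StronglyMeasurable.ite measurableSet_crossing
      (P.stronglyMeasurable_expH_mul_expH _) stronglyMeasurable_const)

theorem stronglyMeasurable_basisIntegrand (P : SpinBoson) (hβ : 0 < P.β)
    (hJ : IntegrableOn (fun ω : ℝ => P.J ω * coth (P.β * ω / 2)) (Ioi 0) P.ν) (i j : ℤˣ)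
    (t : ℝ) (m : ℕ) : StronglyMeasurable (P.basisIntegrand i j t m) := by
  have hsnoc : Measurable fun s : Fin m → ℝ => (Fin.snoc s t : Fin (m + 1) → ℝ) := by
    refine measurable_pi_lambda _ fun k => ?_
    refine Fin.lastCases ?_ (fun k => ?_) k
    · simp
    · simpa using measurable_pi_apply k
  have hc : Measurable fun s : Fin m → ℝ =>
      (-1 : ℂ) ^ negCount s * P.LbHat (Fin.snoc s t : Fin (m + 1) → ℝ) :=
    ((measurable_of_countable fun k : ℕ => (-1 : ℂ) ^ k).comp (measurable_negCount m)).mul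
      ((P.measurable_LbHat (P.continuous_B hβ hJ) (m + 1)).comp hsnoc)
  exact hc.stronglyMeasurable.smul (stronglyMeasurable_pathProduct
    (P.stronglyMeasurable_basisG hβ hJ i j) measurable_const measurable_const measurable_id)

theorem norm_basisIntegrand_le (P : SpinBoson) {C M t : ℝ} {i j : ℤˣ}
    (hC : ∀ x y, ‖P.B x y‖ ≤ C)
    (hM : ∀ x ∈ Icc (-t) t, ∀ y ∈ Icc (-t) t, ‖P.basisG i j x y‖ ≤ M) (ht : 0 ≤ t) (n : ℕ)
    {s : Fin (2 * n + 1) → ℝ} (hs : s ∈ simplex (2 * n + 1) (-t) t) :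
    ‖P.basisIntegrand i j t (2 * n + 1) s‖ ≤
      (2 * (n + 1 : ℕ) : ℝ) ^ (2 * (n + 1)) / (n + 1).factorial * C ^ (n + 1) *
        (M * (‖Ws‖ * M) ^ (2 * n + 1)) := by
  rw [basisIntegrand, norm_smul, norm_neg_one_pow_mul]
  have h1 := P.norm_LbHat_le hC (n := n + 1) (by ring)
    (Fin.snoc s t : Fin (2 * n + 1 + 1) → ℝ)
  exact mul_le_mul h1 (norm_pathProduct_le hM ⟨le_rfl, by linarith⟩ ⟨by linarith, le_rfl⟩ hs.2)
    (norm_nonneg _) ((norm_nonneg _).trans h1)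

theorem integrableOn_basisIntegrand (P : SpinBoson) (hβ : 0 < P.β)
    (hJ : IntegrableOn (fun ω : ℝ => P.J ω * coth (P.β * ω / 2)) (Ioi 0) P.ν) (i j : ℤˣ)
    {t : ℝ} (ht : 0 ≤ t) (n : ℕ) :
    IntegrableOn (P.basisIntegrand i j t (2 * n + 1)) (simplex (2 * n + 1) (-t) t) := by
  obtain ⟨C, _, hC⟩ := P.exists_norm_B_le hβ hJ
  obtain ⟨M, _, hM⟩ := P.exists_norm_basisG_le hβ hJ i j t
  have hbound := fun s (hs : s ∈ simplex (2 * n + 1) (-t) t) =>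
    P.norm_basisIntegrand_le hC hM ht n hs
  exact Measure.integrableOn_of_bounded (volume_simplex_lt_top _ _ _).ne
    (P.stronglyMeasurable_basisIntegrand hβ hJ i j t _).aestronglyMeasurable
    ((ae_restrict_mem (measurableSet_simplex _ _ _)).mono hbound)

/-- The basis series converges absolutely, also when its domains of integration shrink. -/
theorem summable_norm_setIntegral_basisIntegrand (P : SpinBoson) (hβ : 0 < P.β)
    (hJ : IntegrableOn (fun ω : ℝ => P.J ω * coth (P.β * ω / 2)) (Ioi 0) P.ν) (i j : ℤˣ)
    {t : ℝ} (ht : 0 ≤ t) {S : ∀ m : ℕ, Set (Fin m → ℝ)} (hS : ∀ m, S m ⊆ simplex m (-t) t) :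
    Summable fun n : ℕ => ‖Complex.I ^ (2 * n + 1 + 1) •
      ∫ s in S (2 * n + 1), P.basisIntegrand i j t (2 * n + 1) s‖ := by
  obtain ⟨C, hC0, hC⟩ := P.exists_norm_B_le hβ hJ
  obtain ⟨M, hM0, hM⟩ := P.exists_norm_basisG_le hβ hJ i j t
  refine Summable.of_nonneg_of_le (fun n => norm_nonneg _) (fun n => ?_)
    (summable_majorant C M ‖Ws‖ (2 * t))
  rw [norm_smul, norm_pow, Complex.norm_I, one_pow, one_mul]
  have hb := norm_setIntegral_simplex_le (V := 2 * t) (by linarith) (by linarith)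
    (hS (2 * n + 1)) (fun s hs => P.norm_basisIntegrand_le hC hM ht n hs) (by positivity)
  refine hb.trans ?_
  calc _ = (2 * (n + 1 : ℕ) : ℝ) ^ (2 * (n + 1)) / (n + 1).factorial / (2 * n + 1).factorial *
        (C ^ (n + 1) * M * (‖Ws‖ * M * (2 * t)) ^ (2 * n + 1)) := by ring
    _ ≤ _ := mul_le_mul_of_nonneg_right (pairing_factor_le n) (by positivity)

theorem summable_norm_basisKTerm (P : SpinBoson) (hβ : 0 < P.β)
    (hJ : IntegrableOn (fun ω : ℝ => P.J ω * coth (P.β * ω / 2)) (Ioi 0) P.ν) (i j : ℤˣ)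
    {t : ℝ} (ht : 0 ≤ t) : Summable fun n : ℕ => ‖P.basisKTerm i j t (2 * n + 1)‖ := by
  simp only [basisKTerm]
  exact P.summable_norm_setIntegral_basisIntegrand hβ hJ i j ht
    (S := fun m => simplex m (-t) t) fun _ => subset_rfl

theorem summable_norm_basisDTerm (P : SpinBoson) (hβ : 0 < P.β)
    (hJ : IntegrableOn (fun ω : ℝ => P.J ω * coth (P.β * ω / 2)) (Ioi 0) P.ν) (i j : ℤˣ)
    (d : ℝ) {t : ℝ} (ht : 0 ≤ t) : Summable fun n : ℕ => ‖P.basisDTerm i j d t (2 * n + 1)‖ := by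
  simp only [basisDTerm]
  exact P.summable_norm_setIntegral_basisIntegrand hβ hJ i j ht
    (S := fun m => newDomain m d t) fun m => newDomain_subset_simplex m d t


/-! ### Stretching preserves the measure -/

theorem measurable_stretch_one (d : ℝ) :
    Measurable fun x : ℝ => if 0 ≤ x then x + d else x - d :=
  Measurable.ite measurableSet_Ici (by fun_prop) (by fun_prop)

/-- The two half-lines are translated apart, onto disjoint images. -/
theorem measurePreserving_stretch_one {d : ℝ} (hd : 0 ≤ d) :
    MeasurePreserving (fun x : ℝ => if 0 ≤ x then x + d else x - d) volume
      (volume.restrict (Iio (-d) ∪ Ici d)) := by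
  refine ⟨measurable_stretch_one d, Measure.ext fun A hA => ?_⟩
  rw [Measure.map_apply (measurable_stretch_one d) hA, Measure.restrict_apply hA,
    inter_union_distrib_left, measure_union]
  · have h : (fun x : ℝ => if 0 ≤ x then x + d else x - d) ⁻¹' A =
        ((fun x => x + -d) ⁻¹' (A ∩ Iio (-d))) ∪ ((fun x => x + d) ⁻¹' (A ∩ Ici d)) := by
      ext x
      simp only [mem_preimage, mem_union, mem_inter_iff, mem_Iio, mem_Ici]
      split_ifs with hx
      · have : ¬ x + -d < -d := by linarith
        have : d ≤ x + d := by linarith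
        tauto
      · have : x + -d < -d := by linarith
        have : ¬ d ≤ x + d := by linarith
        rw [sub_eq_add_neg]
        tauto
    rw [h, measure_union]
    · rw [measure_preimage_add_right, measure_preimage_add_right]
    · refine Set.disjoint_left.2 fun x hx hx' => ?_
      have h1 := hx.2
      have h2 := hx'.2
      simp only [mem_Iio, mem_Ici] at h1 h2
      linarith
    · exact (hA.inter measurableSet_Ici).preimage (by fun_prop)
  · refine Set.disjoint_left.2 fun x hx hx' => ?_
    have h1 := hx.2
    have h2 := hx'.2
    simp only [mem_Iio, mem_Ici] at h1 h2
    linarith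
  · exact hA.inter measurableSet_Ici

theorem measurePreserving_stretch {d : ℝ} (hd : 0 ≤ d) (m : ℕ) :
    MeasurePreserving (stretch d (m := m)) volume
      (volume.restrict (univ.pi fun _ => Iio (-d) ∪ Ici d)) := by
  have h := measurePreserving_pi (fun _ : Fin m => (volume : Measure ℝ))
    (fun _ => volume.restrict (Iio (-d) ∪ Ici d)) fun _ => measurePreserving_stretch_one hd
  rw [← Measure.restrict_pi_pi] at h
  exact h

theorem stretch_injective {d : ℝ} (hd : 0 ≤ d) (m : ℕ) :
    Function.Injective (stretch d (m := m)) := fun s s' h => by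
  funext k
  have hk := congrFun h k
  simp only [stretch] at hk
  split_ifs at hk <;> linarith

theorem stretch_mem_simplex_iff {d : ℝ} (hd : 0 ≤ d) {m : ℕ} {t : ℝ} {s : Fin m → ℝ} :
    stretch d s ∈ simplex m (-(t + d)) (t + d) ↔ s ∈ simplex m (-t) t := by
  have hle : ∀ i j, stretch d s i ≤ stretch d s j ↔ s i ≤ s j := fun i j => by
    unfold stretch
    split_ifs <;> constructor <;> intro <;> linarith
  have habs : ∀ i, stretch d s i ∈ Icc (-(t + d)) (t + d) ↔ s i ∈ Icc (-t) t := fun i => by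
    rw [mem_Icc, mem_Icc, ← abs_le, ← abs_le, abs_stretch hd, add_le_add_iff_right]
  simp only [simplex, mem_ofPred_eq, Monotone, hle, habs]

theorem measurableSet_newDomain (m : ℕ) (d t : ℝ) : MeasurableSet (newDomain m d t) := by
  have h : newDomain m d t = simplex m (-t) t ∩ ⋃ j, {s | |s j| ≤ d} := by
    ext s
    simp [newDomain]
  rw [h]
  refine (measurableSet_simplex _ _ _).inter (MeasurableSet.iUnion fun j => ?_)
  exact measurableSet_le (by fun_prop) measurable_const

/-- The image of stretching allows a component equal to `d`, whereas the complement of `newDomain`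
demands `|s j| > d`. The sets differ only on the null hyperplanes `s j = d`. -/
theorem simplex_inter_pi_ae_eq (m : ℕ) (d t : ℝ) :
    (simplex m (-t) t ∩ univ.pi fun _ => Iio (-d) ∪ Ici d : Set (Fin m → ℝ)) =ᵐ[volume]
      (simplex m (-t) t \ newDomain m d t : Set (Fin m → ℝ)) := by
  have hnull : ∀ᵐ s : Fin m → ℝ, ∀ j, s j ≠ d := by
    rw [ae_all_iff]
    intro j
    rw [ae_iff]
    simpa [volume_pi] using Measure.pi_hyperplane (fun _ : Fin m => (volume : Measure ℝ)) j d
  rw [Filter.eventuallyEq_set]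
  filter_upwards [hnull] with s hs
  simp only [mem_inter_iff, mem_sdiff, newDomain, mem_ofPred_eq, not_and, not_exists, not_le,
    mem_univ_pi, mem_union, mem_Iio, mem_Ici, lt_abs]
  refine ⟨fun h => ⟨h.1, fun _ j => ?_⟩, fun h => ⟨h.1, fun j => ?_⟩⟩
  · rcases h.2 j with h' | h'
    · exact Or.inr (by linarith)
    · exact Or.inl (lt_of_le_of_ne h' (hs j).symm)
  · rcases h.2 h.1 j with h' | h'
    · exact Or.inr h'.le
    · exact Or.inl (by linarith)

theorem setIntegral_simplex_diff_newDomain {d : ℝ} (hd : 0 ≤ d) (m : ℕ) (t : ℝ)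
    (f : (Fin m → ℝ) → SpinOp) :
    ∫ s in simplex m (-(t + d)) (t + d) \ newDomain m d (t + d), f s =
      ∫ s in simplex m (-t) t, f (stretch d s) := by
  -- An injective Borel map is a measurable embedding here, so the change of variables requires
  -- nothing of `f`.
  have h := (measurePreserving_stretch hd m).setIntegral_preimage_emb
    ((measurePreserving_stretch hd m).measurable.measurableEmbedding (stretch_injective hd m))
    f (simplex m (-(t + d)) (t + d))
  have hpre : stretch d ⁻¹' simplex m (-(t + d)) (t + d) = simplex m (-t) t :=
    Set.ext fun s => stretch_mem_simplex_iff hd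
  rw [hpre, Measure.restrict_restrict (measurableSet_simplex _ _ _)] at h
  rw [h]
  exact setIntegral_congr_set (simplex_inter_pi_ae_eq m d (t + d)).symm

/-! ### The basis functionals on stretched time points -/

/-- Away from the crossing the basis propagator is `fullG`, which does not depend on the indices;
hence they may change freely from `i j` to `k l`. -/
theorem basisG_sub (P : SpinBoson) {x y d : ℝ} (hxy : x ≤ y) (hy : y < 0) (hd : 0 ≤ d)
    (i j k l : ℤˣ) : P.basisG i j (x - d) (y - d) = P.basisG k l x y := by
  rw [basisG, basisG, if_pos (Or.inl ⟨by linarith, by linarith⟩), if_pos (Or.inl ⟨hxy, hy⟩),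
    ← P.fullG_add (a := x - d) (b := y - d) (by linarith) hd (Or.inl (by linarith))]
  simp

theorem basisG_add (P : SpinBoson) {x y d : ℝ} (hxy : x ≤ y) (hx : 0 ≤ x) (hd : 0 ≤ d)
    (i j k l : ℤˣ) : P.basisG i j (x + d) (y + d) = P.basisG k l x y := by
  rw [basisG, basisG, if_pos (Or.inr ⟨by linarith, by linarith⟩), if_pos (Or.inr ⟨hx, hxy⟩),
    P.fullG_add hxy hd (Or.inr hx)]

theorem basisG_crossing (P : SpinBoson) {x y : ℝ} (hx : x < 0) (hy : 0 ≤ y) (i j : ℤˣ) :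
    P.basisG i j x y = P.expH y * ketBra i j * P.expH x := by
  rw [basisG, if_neg, if_pos ⟨hx, hy⟩]
  rintro (h | h)
  · linarith [h.2]
  · linarith [h.1]

/-- The outer exponentials split off `e^{idH}` and `e^{-idH}`, which conjugate `|i⟩⟨j|`. -/
theorem basisG_crossing_stretch (P : SpinBoson) {x y d : ℝ} (hx : x < 0) (hy : 0 ≤ y)
    (hd : 0 ≤ d) (i j : ℤˣ) :
    P.basisG i j (x - d) (y + d) = ∑ k, ∑ l, P.shiftCoeff d i j k l • P.basisG k l x y := by
  simp only [P.basisG_crossing hx hy]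
  rw [P.basisG_crossing (by linarith) (by linarith), P.expH_add,
    show x - d = -d + x by ring, P.expH_add]
  calc _ = P.expH y * (P.expH d * ketBra i j * P.expH (-d)) * P.expH x := by
        simp only [mul_assoc]
    _ = _ := by
        rw [P.shiftCoeff_spec]
        simp only [Finset.mul_sum, Finset.sum_mul, mul_smul_comm, smul_mul_assoc]

theorem pathProduct_basisG_of_neg (P : SpinBoson) {a b d : ℝ} (hab : a ≤ b) (hb : b < 0)
    (hd : 0 ≤ d) (i j k l : ℤˣ) {m : ℕ} {s : Fin m → ℝ} (hs : s ∈ simplex m a b) :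
    pathProduct (P.basisG i j) Ws (a - d) m (stretch d s) (b - d) =
      pathProduct (P.basisG k l) Ws a m s b :=
  pathProduct_congr (R := Iio 0) (φ := fun x => if 0 ≤ x then x + d else x - d)
    (fun x hx y hy hxy => by
      rw [if_neg (not_le.2 hx), if_neg (not_le.2 hy)]
      exact P.basisG_sub hxy hy hd i j k l)
    (hab.trans_lt hb) hb hab (by rw [if_neg (not_le.2 (hab.trans_lt hb))])
    (by rw [if_neg (not_le.2 hb)]) (fun i => (hs.2 i).2.trans_lt hb) hs

theorem pathProduct_basisG_stretch (P : SpinBoson) {a b d : ℝ} (ha : a < 0) (hb : 0 ≤ b)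
    (hd : 0 ≤ d) (i j : ℤˣ) {m : ℕ} {s : Fin m → ℝ} (hs : s ∈ simplex m a b) :
    pathProduct (P.basisG i j) Ws (a - d) m (stretch d s) (b + d) =
      ∑ k, ∑ l, P.shiftCoeff d i j k l • pathProduct (P.basisG k l) Ws a m s b := by
  induction m generalizing b with
  | zero => exact P.basisG_crossing_stretch ha hb hd i j
  | succ m ih =>
    have hs' := castSucc_mem_simplex hs
    have hlast := hs.2 (Fin.last m)
    simp only [pathProduct]
    -- If the last time is nonnegative, the last factor is one-sided and the crossing lies further
    -- back, in the induction hypothesis. Otherwise the last factor is the crossing and the rest of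
    -- the path is negative.
    by_cases h : 0 ≤ s (Fin.last m)
    · have e : stretch d s (Fin.last m) = s (Fin.last m) + d := if_pos h
      rw [e]
      have := ih h hs'
      change P.basisG i j _ _ * Ws *
        pathProduct (P.basisG i j) Ws (a - d) m (stretch d fun k : Fin m => s k.castSucc) _ = _
      rw [this]
      simp only [Finset.mul_sum, mul_smul_comm]
      refine Finset.sum_congr rfl fun k _ => Finset.sum_congr rfl fun l _ => ?_
      rw [P.basisG_add hlast.2 h hd i j k l]
    · have e : stretch d s (Fin.last m) = s (Fin.last m) - d := if_neg h
      rw [e]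
      change P.basisG i j _ _ * Ws *
        pathProduct (P.basisG i j) Ws (a - d) m (stretch d fun k : Fin m => s k.castSucc) _ = _
      rw [P.basisG_crossing_stretch (not_le.1 h) hb hd]
      simp only [Finset.sum_mul, smul_mul_assoc]
      refine Finset.sum_congr rfl fun k _ => Finset.sum_congr rfl fun l _ => ?_
      rw [P.pathProduct_basisG_of_neg hlast.1 (not_le.1 h) hd i j k l hs']

theorem basisIntegrand_stretch (P : SpinBoson) {t d : ℝ} (ht : 0 < t) (hd : 0 ≤ d) (i j : ℤˣ)
    {m : ℕ} {s : Fin m → ℝ} (hs : s ∈ simplex m (-t) t) :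
    P.basisIntegrand i j (t + d) m (stretch d s) =
      ∑ k, ∑ l, P.shiftCoeff d i j k l • P.basisIntegrand k l t m s := by
  have h := P.pathProduct_basisG_stretch (neg_lt_zero.2 ht) ht.le hd i j hs
  rw [show -t - d = -(t + d) by ring] at h
  simp only [basisIntegrand, basisU]
  rw [h, negCount_stretch hd, P.LbHat_snoc_stretch ht.le hd]
  simp only [Finset.smul_sum]
  refine Finset.sum_congr rfl fun k _ => Finset.sum_congr rfl fun l _ => ?_
  exact smul_comm _ _ _

/-! ### The recurrence -/

theorem volume_simplex_self {m : ℕ} (hm : m ≠ 0) (a : ℝ) : volume (simplex m a a) = 0 := by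
  have h := volume_simplex_le m a a le_rfl
  rw [sub_self, zero_pow hm, zero_div, ENNReal.ofReal_zero] at h
  exact le_antisymm h bot_le

theorem setIntegral_basisIntegrand_stretch (P : SpinBoson) (hβ : 0 < P.β)
    (hJ : IntegrableOn (fun ω : ℝ => P.J ω * coth (P.β * ω / 2)) (Ioi 0) P.ν) (i j : ℤˣ)
    {t d : ℝ} (ht : 0 ≤ t) (hd : 0 ≤ d) (n : ℕ) :
    ∫ s in simplex (2 * n + 1) (-t) t, P.basisIntegrand i j (t + d) (2 * n + 1) (stretch d s) =
      ∑ k, ∑ l, P.shiftCoeff d i j k l •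
        ∫ s in simplex (2 * n + 1) (-t) t, P.basisIntegrand k l t (2 * n + 1) s := by
  -- At `t = 0` the unstretched path has no crossing factor, so the pointwise identity is
  -- unavailable; but the simplex is then a null set.
  rcases ht.eq_or_lt with rfl | ht'
  · have h0 : volume (simplex (2 * n + 1) (-0) 0) = 0 := by
      rw [neg_zero]
      exact volume_simplex_self (by omega) 0
    simp only [setIntegral_measure_zero _ h0]
    exact (Finset.sum_eq_zero fun k _ => Finset.sum_eq_zero fun l _ => smul_zero _).symm
  have hint : ∀ k l, Integrable
      (fun s => P.shiftCoeff d i j k l • P.basisIntegrand k l t (2 * n + 1) s)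
      (volume.restrict (simplex (2 * n + 1) (-t) t)) := fun k l =>
    (P.integrableOn_basisIntegrand hβ hJ k l ht n).smul (P.shiftCoeff d i j k l)
  rw [setIntegral_congr_fun (measurableSet_simplex _ _ _)
    fun s hs => P.basisIntegrand_stretch ht' hd i j hs]
  refine (integral_finsetSum _ fun k _ => integrable_finsetSum _ fun l _ => hint k l).trans ?_
  refine Finset.sum_congr rfl fun k _ => ?_
  refine (integral_finsetSum _ fun l _ => hint k l).trans ?_
  exact Finset.sum_congr rfl fun l _ => integral_smul _ _

theorem basisKTerm_add (P : SpinBoson) (hβ : 0 < P.β)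
    (hJ : IntegrableOn (fun ω : ℝ => P.J ω * coth (P.β * ω / 2)) (Ioi 0) P.ν) (i j : ℤˣ)
    {t d : ℝ} (ht : 0 ≤ t) (hd : 0 ≤ d) (n : ℕ) :
    P.basisKTerm i j (t + d) (2 * n + 1) =
      ∑ k, ∑ l, P.shiftCoeff d i j k l • P.basisKTerm k l t (2 * n + 1) +
        P.basisDTerm i j d (t + d) (2 * n + 1) := by
  -- Splitting along `newDomain`: the inner part is the `basisD` term, and the rest is the stretched
  -- image of the smaller simplex.
  have hsplit := integral_inter_add_sdiff (measurableSet_newDomain (2 * n + 1) d (t + d))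
    (P.integrableOn_basisIntegrand hβ hJ i j (add_nonneg ht hd) n)
  rw [inter_eq_right.2 (newDomain_subset_simplex _ _ _),
    setIntegral_simplex_diff_newDomain hd,
    P.setIntegral_basisIntegrand_stretch hβ hJ i j ht hd] at hsplit
  simp only [basisKTerm, basisDTerm]
  rw [← hsplit, smul_add, add_comm]
  simp only [Finset.smul_sum]
  congr 1
  refine Finset.sum_congr rfl fun k _ => Finset.sum_congr rfl fun l _ => ?_
  exact smul_comm _ _ _

theorem basisK_add (P : SpinBoson) (hβ : 0 < P.β)
    (hJ : IntegrableOn (fun ω : ℝ => P.J ω * coth (P.β * ω / 2)) (Ioi 0) P.ν) (i j : ℤˣ)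
    {t d : ℝ} (ht : 0 ≤ t) (hd : 0 ≤ d) :
    P.basisK i j (t + d) =
      ∑ k, ∑ l, P.shiftCoeff d i j k l • P.basisK k l t + P.basisD i j d (t + d) := by
  have hK := fun k l => (P.summable_norm_basisKTerm hβ hJ k l ht).of_norm.hasSum
  have hD := (P.summable_norm_basisDTerm hβ hJ i j d (add_nonneg ht hd)).of_norm.hasSum
  refine HasSum.tsum_eq ?_
  simp only [P.basisKTerm_add hβ hJ i j ht hd]
  exact (hasSum_sum fun k _ => hasSum_sum fun l _ => (hK k l).const_smul _).add hD

end SpinBoson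

theorem mainTheorem3 (P : SpinBoson) (hβ : 0 < P.β)
    (hJ : MeasureTheory.IntegrableOn (fun ω : ℝ => P.J ω * SpinBoson.coth (P.β * ω / 2))
      (Set.Ioi 0) P.ν) :
    -- the series defining the full propagator converges absolutely
    (∀ a b : ℝ, a ≤ b →
      (∀ n : ℕ, MeasureTheory.IntegrableOn (P.fullIntegrand a b (2 * n + 2))
        (SpinBoson.simplex (2 * n + 2) a b)) ∧
      Summable (fun n : ℕ => ‖P.fullTerm a b (2 * n + 2)‖)) ∧
    -- shift invariance of the full propagator on each side of 0
    (∀ a b Δt : ℝ, a ≤ b → 0 ≤ Δt → (b + Δt < 0 ∨ 0 ≤ a) →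
      P.fullG (a + Δt) (b + Δt) = P.fullG a b) ∧
    -- invariance of the bath influence functional
    (∀ (t Δt : ℝ) (m : ℕ) (s : Fin m → ℝ), 0 ≤ t → 0 ≤ Δt → Odd m →
      s ∈ SpinBoson.simplex m (-t) t →
      P.LbHat (Fin.snoc (SpinBoson.stretch Δt s) (t + Δt) : Fin (m + 1) → ℝ) =
        P.LbHat (Fin.snoc s t : Fin (m + 1) → ℝ)) ∧
    -- the basis series converge absolutely
    (∀ (i j : ℤˣ) (t : ℝ), 0 ≤ t →
      (∀ n : ℕ, MeasureTheory.IntegrableOn (P.basisIntegrand i j t (2 * n + 1))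
        (SpinBoson.simplex (2 * n + 1) (-t) t)) ∧
      Summable (fun n : ℕ => ‖P.basisKTerm i j t (2 * n + 1)‖)) ∧
    -- the series of the newly added part converges absolutely, and the recurrence holds
    (∀ (i j : ℤˣ) (t Δt : ℝ), 0 ≤ t → 0 ≤ Δt →
      Summable (fun n : ℕ => ‖P.basisDTerm i j Δt (t + Δt) (2 * n + 1)‖) ∧
      P.basisK i j (t + Δt) =
        ∑ k, ∑ l, P.shiftCoeff Δt i j k l • P.basisK k l t + P.basisD i j Δt (t + Δt)) :=
  ⟨fun a b _ => ⟨P.integrableOn_fullIntegrand hβ hJ a b, P.summable_norm_fullTerm hβ hJ a b⟩,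
    fun _ _ _ hab hd h => P.fullG_add hab hd h,
    fun _ _ _ s ht hd _ _ => P.LbHat_snoc_stretch ht hd s,
    fun i j _ ht => ⟨P.integrableOn_basisIntegrand hβ hJ i j ht,
      P.summable_norm_basisKTerm hβ hJ i j ht⟩,
    fun i j _ d ht hd => ⟨P.summable_norm_basisDTerm hβ hJ i j d (add_nonneg ht hd),
      P.basisK_add hβ hJ i j ht hd⟩⟩
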